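/- Let $R$ be an associative ring with unit, not necessarily commutative, let $M$ be a right $R$-module, let $\mathcal Q$ be a class of left $R$-modules, and put $\kappa = |R| + \aleph_0$. A right $R$-module $N$ is called $\mathcal Q$-Mittag-Leffler if for every family $(Q_i \mid i \in I)$ of members of $\mathcal Q$ the canonical group homomorphism $N \otimes_R \prod_{i \in I} Q_i \to \prod_{i \in I} (N \otimes_R Q_i)$, $n \otimes (q_i)_{i \in I} \mapsto (n \otimes q_i)_{i \in I}$, is injective. A submodule $N \subseteq M$ is pure if $N \otimes_R A \to M \otimes_R A$ is injective for every left $R$-module $A$. A right $R$-module $N$ is countably presented if there is an exact sequence $R^{(\mathbb N)} \to R^{(\mathbb N)} \to N \to 0$ of right $R$-modules. Chains below are nonempty. The following conditions (i)--(iv) are equivalent: (i) $M$ is a flat $\mathcal Q$-Mittag-Leffler module. (ii) For each subset $C$ of $M$ of cardinality $\le \kappa$ there is a pure submodule $N$ of $M$ of cardinality $\le \kappa$ such that $C \subseteq N$ and $N$ is flat and $\mathcal Q$-Mittag-Leffler. (iii) There is a set $\mathcal S$ of pure submodules of $M$, each of which is flat, $\mathcal Q$-Mittag-Leffler and of cardinality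 $\le \kappa$, such that each subset $C$ of $M$ of cardinality $\le \kappa$ is contained in some $N \in \mathcal S$, and such that $\mathcal S$ is closed under unions of well-ordered chains of length $\le \kappa$, i.e. $\bigcup_{\alpha < \sigma} N_\alpha \in \mathcal S$ for each ordinal $0 < \sigma \le \kappa$ and each increasing sequence $(N_\alpha \mid \alpha < \sigma)$ of members of $\mathcal S$. (iv) There is a set $\mathcal T$ of submodules of $M$, directed by inclusion, with union $M$, consisting of flat $\mathcal Q$-Mittag-Leffler modules, and closed under unions of countable chains $N_0 \subseteq N_1 \subseteq N_2 \subseteq \cdots$. Consider also the following condition: (v) There is a set $\mathcal U$ of countably presented flat $\mathcal Q$-Mittag-Leffler submodules $N$ of $M$ such that $N \otimes_R Q \to M \otimes_R Q$ is injective for each $N \in \mathcal U$ and each $Q \in \mathcal Q$, and such that (a) each countable subset of $M$ is contained in some $N \in \mathcal U$, and (b) $\mathcal U$ is closed under unions of countable chains $N_0 \subseteq N_1 \subseteq N_2 \subseteq \cdots$. Then (v) implies (i); and if the left $R$-module $R$ belongs to $\mathcal Q$, then (v) is equivalent to (i). -/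

import Mathlib

/-!
Right `R`-modules over an arbitrary (associative, unital, not necessarily commutative) ring `R`
are modules over `Rᵐᵒᵖ`; the right action is `m · r = MulOpposite.op r • m`.
-/

open scoped TensorProduct Cardinal

universe u

namespace RelML

section Tensor

variable (R : Type*) [Ring R]
variable (M : Type*) [AddCommGroup M] [Module Rᵐᵒᵖ M]
variable (Q : Type*) [AddCommGroup Q] [Module R Q]

/-- The subgroup of `M ⊗[ℤ] Q` generated by the elements `(m · r) ⊗ q - m ⊗ (r • q)`. -/
def balancing : Submodule ℤ (M ⊗[ℤ] Q) :=
  Submodule.span ℤ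
    {x | ∃ (m : M) (r : R) (q : Q), x = (MulOpposite.op r • m) ⊗ₜ[ℤ] q - m ⊗ₜ[ℤ] (r • q)}

/-- The tensor product `M ⊗_R Q` of a right `R`-module `M` and a left `R`-module `Q`,
an abelian group. -/
abbrev Tensor : Type _ := (M ⊗[ℤ] Q) ⧸ balancing R M Q

variable {M Q}

/-- The pure tensor `m ⊗ q` in `M ⊗_R Q`. -/
def tmul (m : M) (q : Q) : Tensor R M Q := (balancing R M Q).mkQ (m ⊗ₜ[ℤ] q)

theorem tmul_balanced (m : M) (r : R) (q : Q) :
    tmul R (MulOpposite.op r • m) q = tmul R m (r • q) := by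
  rw [tmul, tmul, ← sub_eq_zero, ← map_sub]
  exact (Submodule.Quotient.mk_eq_zero _).2 (Submodule.subset_span ⟨m, r, q, rfl⟩)

variable {R}
variable {M' : Type*} [AddCommGroup M'] [Module Rᵐᵒᵖ M']
variable {Q' : Type*} [AddCommGroup Q'] [Module R Q']

theorem balancing_le_comap (f : M →ₗ[Rᵐᵒᵖ] M') (g : Q →ₗ[R] Q') :
    balancing R M Q ≤ (balancing R M' Q').comap
      (TensorProduct.map f.toAddMonoidHom.toIntLinearMap g.toAddMonoidHom.toIntLinearMap) := by
  refine Submodule.span_le.2 ?_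
  rintro _ ⟨m, r, q, rfl⟩
  refine Submodule.subset_span ⟨f m, r, g q, ?_⟩
  simp

/-- The group homomorphism `f ⊗_R g : M ⊗_R Q → M' ⊗_R Q'`, `m ⊗ q ↦ f m ⊗ g q`. -/
def tensorMap (f : M →ₗ[Rᵐᵒᵖ] M') (g : Q →ₗ[R] Q') : Tensor R M Q →ₗ[ℤ] Tensor R M' Q' :=
  (balancing R M Q).mapQ (balancing R M' Q')
    (TensorProduct.map f.toAddMonoidHom.toIntLinearMap g.toAddMonoidHom.toIntLinearMap)
    (balancing_le_comap f g)

theorem tensorMap_tmul (f : M →ₗ[Rᵐᵒᵖ] M') (g : Q →ₗ[R] Q') (m : M) (q : Q) :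
    tensorMap f g (tmul R m q) = tmul R (f m) (g q) := rfl

variable (R M) in
/-- The canonical map `M ⊗_R ∏ᵢ Qᵢ → ∏ᵢ (M ⊗_R Qᵢ)`. -/
def tensorPi {I : Type*} (P : I → Type*) [∀ i, AddCommGroup (P i)] [∀ i, Module R (P i)] :
    Tensor R M (∀ i, P i) →ₗ[ℤ] ∀ i, Tensor R M (P i) :=
  LinearMap.pi fun i => tensorMap LinearMap.id (LinearMap.proj i)

theorem tensorPi_tmul {I : Type*} (P : I → Type*) [∀ i, AddCommGroup (P i)]
    [∀ i, Module R (P i)] (m : M) (q : ∀ i, P i) :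
    tensorPi R M P (tmul R m q) = fun i => tmul R m (q i) := rfl

end Tensor

section Modules

variable (R : Type u) [Ring R] (M : Type u) [AddCommGroup M] [Module Rᵐᵒᵖ M]

/-- The right `R`-module `M` is flat: `M ⊗_R -` preserves injectivity of maps of left
`R`-modules. -/
def IsFlat : Prop :=
  ∀ (A B : Type u) [AddCommGroup A] [Module R A] [AddCommGroup B] [Module R B] (g : A →ₗ[R] B),
    Function.Injective g →
      Function.Injective (tensorMap (LinearMap.id : M →ₗ[Rᵐᵒᵖ] M) g)

/-- The right `R`-module `M` is `𝒬`-Mittag-Leffler: the canonical map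
`M ⊗_R ∏ᵢ Qᵢ → ∏ᵢ (M ⊗_R Qᵢ)` is injective for each family of members of `𝒬`. -/
def IsMittagLeffler (𝒬 : Set (ModuleCat.{u} R)) : Prop :=
  ∀ (I : Type u) (Q : I → ModuleCat.{u} R), (∀ i, Q i ∈ 𝒬) →
    Function.Injective (tensorPi R M fun i => Q i)

/-- `M` is countably presented: there is an exact sequence `R^(ℕ) → R^(ℕ) → M → 0` of right
`R`-modules (the right module `R` is `Rᵐᵒᵖ` as a module over itself). -/
def IsCountablyPresented : Prop :=
  ∃ (g : (ℕ →₀ Rᵐᵒᵖ) →ₗ[Rᵐᵒᵖ] (ℕ →₀ Rᵐᵒᵖ)) (f : (ℕ →₀ Rᵐᵒᵖ) →ₗ[Rᵐᵒᵖ] M),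
    Function.Exact g f ∧ Function.Surjective f

variable {M}

/-- The inclusion of the submodule `N` into `M` stays injective after tensoring with the left
`R`-module `A`. -/
def StaysInjective (N : Submodule Rᵐᵒᵖ M) (A : Type u) [AddCommGroup A] [Module R A] : Prop :=
  Function.Injective (tensorMap N.subtype (LinearMap.id : A →ₗ[R] A))

/-- `N` is a pure submodule of the right `R`-module `M`. -/
def IsPureSubmodule (N : Submodule Rᵐᵒᵖ M) : Prop :=
  ∀ (A : Type u) [AddCommGroup A] [Module R A], StaysInjective R N A

variable {R}

/-- The system `𝒯` of submodules is closed under unions of countable chains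
`N 0 ⊆ N 1 ⊆ N 2 ⊆ ⋯` (the supremum of such a chain is its union). -/
def ClosedUnderCountableChains (𝒯 : Set (Submodule Rᵐᵒᵖ M)) : Prop :=
  ∀ N : ℕ → Submodule Rᵐᵒᵖ M, Monotone N → (∀ n, N n ∈ 𝒯) → ⨆ n, N n ∈ 𝒯

/-- The system `𝒮` of submodules is closed under unions of nonempty well-ordered chains
`(N α ∣ α < σ)` of length `σ ≤ κ`, where `κ` is identified with its initial ordinal. -/
def ClosedUnderChains (κ : Cardinal.{u}) (𝒮 : Set (Submodule Rᵐᵒᵖ M)) : Prop :=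
  ∀ σ : Ordinal.{u}, 0 < σ → σ ≤ κ.ord →
    ∀ N : Set.Iio σ → Submodule Rᵐᵒᵖ M, Monotone N → (∀ α, N α ∈ 𝒮) → ⨆ α, N α ∈ 𝒮

/-- There is a system `𝒰` of countably presented flat `𝒬`-Mittag-Leffler submodules of `M` whose
inclusions into `M` stay injective after tensoring with any member of `𝒬`, such that (a) each
countable subset of `M` lies in a member of `𝒰`, and (b) `𝒰` is closed under unions of countable
chains. -/
def HasCountablyPresentedSystem (R : Type u) [Ring R] (M : Type u) [AddCommGroup M]
    [Module Rᵐᵒᵖ M] (𝒬 : Set (ModuleCat.{u} R)) : Prop :=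
  ∃ 𝒰 : Set (Submodule Rᵐᵒᵖ M),
    (∀ N ∈ 𝒰, IsCountablyPresented R N ∧ IsFlat R N ∧ IsMittagLeffler R N 𝒬 ∧
      ∀ Q ∈ 𝒬, StaysInjective R N Q) ∧
    (∀ C : Set M, C.Countable → ∃ N ∈ 𝒰, C ⊆ N) ∧
    ClosedUnderCountableChains 𝒰

end Modules

end RelML

/-! Flatness and the Mittag-Leffler property pass to pure submodules. Closing a set of size at most
`κ` under chosen solutions of finite linear systems, `ω` times, gives a pure submodule of size at
most `κ` (`exists_isPureSubmodule`), whence (ii). For (iii) all small pure flat Mittag-Leffler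
submodules serve: the union of a chain of them is pure and small, so (ii) places it inside a flat
Mittag-Leffler submodule, from which it inherits both properties.

The core of (iv) ⇒ (i) is `isMittagLeffler_sSup`. If a nonzero tensor over the union had only zero
coordinates, there would be a countable chain in the system along which at each stage some
coordinate is still alive and dies at the next. Restricted to these countably many coordinates, the
tensor vanishes over the union of the chain, which is Mittag-Leffler, hence at a finite stage, where
one of the coordinates is still alive. Condition (v) is a case of (iv).

For (i) ⇒ (v), `exists_uniform_factorization` combines flatness and Mittag-Leffler: one
factorization of a finite sequence trivializes all its relations over `𝒬`. When `R` belongs to `𝒬`,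
this factors the inclusion into `M` of a finitely generated submodule through a finite free module
(`exists_factorization_of_fg`). Iterating countably often yields the members of the system. -/

namespace RelML

/-! ### Tensor products over a noncommutative ring: right exactness, relations, free modules. -/

section TensorCalculus

variable {R : Type*} [Ring R]
variable {M : Type*} [AddCommGroup M] [Module Rᵐᵒᵖ M]
variable {M' : Type*} [AddCommGroup M'] [Module Rᵐᵒᵖ M']
variable {M'' : Type*} [AddCommGroup M''] [Module Rᵐᵒᵖ M'']
variable {Q : Type*} [AddCommGroup Q] [Module R Q]
variable {Q' : Type*} [AddCommGroup Q'] [Module R Q']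
variable {Q'' : Type*} [AddCommGroup Q''] [Module R Q'']

theorem tmul_add (m : M) (q q' : Q) : tmul R m (q + q') = tmul R m q + tmul R m q' := by
  simp only [tmul, TensorProduct.tmul_add, map_add]

theorem add_tmul (m m' : M) (q : Q) : tmul R (m + m') q = tmul R m q + tmul R m' q := by
  simp only [tmul, TensorProduct.add_tmul, map_add]

/-- The pure tensor as a biadditive map. -/
def tmulHom (R : Type*) [Ring R] (M : Type*) [AddCommGroup M] [Module Rᵐᵒᵖ M]
    (Q : Type*) [AddCommGroup Q] [Module R Q] : M →+ Q →+ Tensor R M Q :=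
  AddMonoidHom.mk' (fun m => AddMonoidHom.mk' (fun q => tmul R m q) (tmul_add m))
    fun m m' => by ext q; exact add_tmul m m' q

theorem tmul_zero (m : M) : tmul R m (0 : Q) = 0 := map_zero (tmulHom R M Q m)

theorem zero_tmul (q : Q) : tmul R (0 : M) q = 0 := map_zero ((tmulHom R M Q).flip q)

theorem sum_tmul {ι : Type*} (s : Finset ι) (m : ι → M) (q : Q) :
    tmul R (∑ i ∈ s, m i) q = ∑ i ∈ s, tmul R (m i) q :=
  map_sum ((tmulHom R M Q).flip q) m s

theorem exists_sum_tmul (z : Tensor R M Q) :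
    ∃ (n : ℕ) (m : Fin n → M) (q : Fin n → Q), z = ∑ i, tmul R (m i) (q i) := by
  obtain ⟨y, rfl⟩ := (balancing R M Q).mkQ_surjective z
  obtain ⟨k, m, n, rfl⟩ := TensorProduct.exists_sum_tmul_eq y
  exact ⟨k, m, n, by simp only [map_sum]; rfl⟩

theorem tensor_induction {p : Tensor R M Q → Prop} (zero : p 0)
    (tmul : ∀ m q, p (tmul R m q)) (add : ∀ x y, p x → p y → p (x + y)) (z : Tensor R M Q) :
    p z := by
  obtain ⟨n, m, q, rfl⟩ := exists_sum_tmul z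
  exact Finset.sum_induction _ p add zero fun i _ => tmul _ _

theorem tensor_hom_ext {G : Type*} [AddCommGroup G] {f g : Tensor R M Q →ₗ[ℤ] G}
    (h : ∀ m q, f (tmul R m q) = g (tmul R m q)) : f = g := by
  refine LinearMap.ext fun z => ?_
  induction z using tensor_induction with
  | zero => simp
  | tmul m q => exact h m q
  | add x y hx hy => simp [hx, hy]

/-- The homomorphism out of `M ⊗_R Q` induced by a balanced biadditive map. -/
def tensorLift {G : Type*} [AddCommGroup G] (β : M →+ Q →+ G)
    (h : ∀ m (r : R) q, β (MulOpposite.op r • m) q = β m (r • q)) : Tensor R M Q →ₗ[ℤ] G :=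
  (balancing R M Q).liftQ
    (TensorProduct.lift (LinearMap.mk₂ ℤ (fun m q => β m q) (by simp) (by simp) (by simp)
      (by simp))) <| by
    refine Submodule.span_le.2 ?_
    rintro _ ⟨m, r, q, rfl⟩
    exact LinearMap.mem_ker.2 ((map_sub _ _ _).trans (sub_eq_zero.2 (h m r q)))

theorem tensorMap_tensorMap (f : M →ₗ[Rᵐᵒᵖ] M') (f' : M' →ₗ[Rᵐᵒᵖ] M'') (g : Q →ₗ[R] Q')
    (g' : Q' →ₗ[R] Q'') (z : Tensor R M Q) :
    tensorMap f' g' (tensorMap f g z) = tensorMap (f' ∘ₗ f) (g' ∘ₗ g) z :=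
  DFunLike.congr_fun (tensor_hom_ext (f := tensorMap f' g' ∘ₗ tensorMap f g)
    (g := tensorMap (f' ∘ₗ f) (g' ∘ₗ g)) fun _ _ => rfl) z

theorem tensorMap_id_id (z : Tensor R M Q) :
    tensorMap (LinearMap.id : M →ₗ[Rᵐᵒᵖ] M) (LinearMap.id : Q →ₗ[R] Q) z = z :=
  DFunLike.congr_fun (tensor_hom_ext (f := tensorMap LinearMap.id LinearMap.id)
    (g := LinearMap.id) fun _ _ => rfl) z

theorem tensorMap_comm (f : M →ₗ[Rᵐᵒᵖ] M') (g : Q →ₗ[R] Q') (z : Tensor R M Q) :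
    tensorMap LinearMap.id g (tensorMap f LinearMap.id z) =
      tensorMap f LinearMap.id (tensorMap LinearMap.id g z) := by
  simp only [tensorMap_tensorMap, LinearMap.id_comp, LinearMap.comp_id]

theorem tensorMap_surjective_left {f : M →ₗ[Rᵐᵒᵖ] M'} (hf : Function.Surjective f) :
    Function.Surjective (tensorMap f (LinearMap.id : Q →ₗ[R] Q)) := fun z => by
  obtain ⟨n, m, q, rfl⟩ := exists_sum_tmul z
  choose m' hm' using fun i => hf (m i)
  exact ⟨∑ i, tmul R (m' i) (q i), by simp [map_sum, tensorMap_tmul, hm']⟩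

/-- Right exactness of `- ⊗_R Q`. -/
theorem exists_of_tensorMap_left_eq_zero {f : M →ₗ[Rᵐᵒᵖ] M'} (hf : Function.Surjective f)
    {z : Tensor R M Q} (hz : tensorMap f (LinearMap.id : Q →ₗ[R] Q) z = 0) :
    ∃ y : Tensor R (LinearMap.ker f) Q,
      tensorMap (LinearMap.ker f).subtype LinearMap.id y = z := by
  let T := LinearMap.range
    (tensorMap (LinearMap.ker f).subtype (LinearMap.id : Q →ₗ[R] Q))
  have key : ∀ (m m' : M) (q : Q), f m = f m' →
      T.mkQ (tmul R m q) = T.mkQ (tmul R m' q) := fun m m' q h => by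
    rw [← sub_eq_zero, ← map_sub, Submodule.mkQ_apply, Submodule.Quotient.mk_eq_zero]
    refine ⟨tmul R ⟨m - m', by simp [h]⟩ q, ?_⟩
    rw [tensorMap_tmul, eq_sub_iff_add_eq, LinearMap.id_apply, ← add_tmul]
    simp
  -- A set-theoretic section suffices: by `key` its choices do not matter modulo `T`, so it induces
  -- a homomorphism from the target to the cokernel.
  let σ := Function.surjInv hf
  have hσ : ∀ x, f (σ x) = x := Function.surjInv_eq hf
  let β : M' →+ Q →+ (Tensor R M Q ⧸ T) :=
    AddMonoidHom.mk' (fun m => T.mkQ.toAddMonoidHom.comp (tmulHom R M Q (σ m))) fun m m' => by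
      ext q
      change T.mkQ (tmul R _ q) = T.mkQ (tmul R _ q) + T.mkQ (tmul R _ q)
      rw [← map_add, ← add_tmul]
      exact key _ _ _ (by simp [hσ])
  have hβ : ∀ m (r : R) q, β (MulOpposite.op r • m) q = β m (r • q) := fun m r q => by
    change T.mkQ (tmul R _ q) = T.mkQ (tmul R _ (r • q))
    rw [← tmul_balanced]
    exact key _ _ _ (by simp [hσ])
  have : tensorLift β hβ ∘ₗ tensorMap f LinearMap.id = T.mkQ :=
    tensor_hom_ext fun m q => key _ _ _ (hσ _)
  have h := DFunLike.congr_fun this z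
  rw [LinearMap.comp_apply, hz, map_zero] at h
  exact (Submodule.Quotient.mk_eq_zero T).1 h.symm

/-- Right exactness of `M ⊗_R -`. -/
theorem exists_of_tensorMap_right_eq_zero {g : Q →ₗ[R] Q'} (hg : Function.Surjective g)
    {z : Tensor R M Q} (hz : tensorMap (LinearMap.id : M →ₗ[Rᵐᵒᵖ] M) g z = 0) :
    ∃ y : Tensor R M (LinearMap.ker g),
      tensorMap LinearMap.id (LinearMap.ker g).subtype y = z := by
  let T := LinearMap.range
    (tensorMap (LinearMap.id : M →ₗ[Rᵐᵒᵖ] M) (LinearMap.ker g).subtype)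
  have key : ∀ (m : M) (q q' : Q), g q = g q' →
      T.mkQ (tmul R m q) = T.mkQ (tmul R m q') := fun m q q' h => by
    rw [← sub_eq_zero, ← map_sub, Submodule.mkQ_apply, Submodule.Quotient.mk_eq_zero]
    refine ⟨tmul R m ⟨q - q', by simp [h]⟩, ?_⟩
    rw [tensorMap_tmul, eq_sub_iff_add_eq, LinearMap.id_apply, ← tmul_add]
    simp
  let σ := Function.surjInv hg
  have hσ : ∀ x, g (σ x) = x := Function.surjInv_eq hg
  let β : M →+ Q' →+ (Tensor R M Q ⧸ T) :=
    (AddMonoidHom.mk' (fun q => T.mkQ.toAddMonoidHom.comp ((tmulHom R M Q).flip (σ q)))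
      fun q q' => by
        ext m
        change T.mkQ (tmul R m _) = T.mkQ (tmul R m _) + T.mkQ (tmul R m _)
        rw [← map_add, ← tmul_add]
        exact key _ _ _ (by simp [hσ])).flip
  have hβ : ∀ m (r : R) q, β (MulOpposite.op r • m) q = β m (r • q) := fun m r q => by
    change T.mkQ (tmul R _ _) = T.mkQ (tmul R m _)
    rw [tmul_balanced]
    exact key _ _ _ (by simp [hσ])
  have : tensorLift β hβ ∘ₗ tensorMap LinearMap.id g = T.mkQ :=
    tensor_hom_ext fun m q => key _ _ _ (hσ _)
  have h := DFunLike.congr_fun this z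
  rw [LinearMap.comp_apply, hz, map_zero] at h
  exact (Submodule.Quotient.mk_eq_zero T).1 h.symm

/-- A relation `∑ mᵢ ⊗ qᵢ = 0` in `M ⊗_R Q` comes from finitely many linear relations between
elements of `M`. -/
theorem exists_relations_of_sum_tmul_eq_zero {n : ℕ} {m : Fin n → M} {q : Fin n → Q}
    (h : ∑ i, tmul R (m i) (q i) = 0) :
    ∃ (L : ℕ) (k : Fin L → M →₀ Rᵐᵒᵖ) (b : Fin L → Q),
      (∀ l, Finsupp.linearCombination Rᵐᵒᵖ id (k l) = (0 : M)) ∧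
      ∑ i, tmul R (Finsupp.single (m i) (1 : Rᵐᵒᵖ)) (q i) = ∑ l, tmul R (k l) (b l) := by
  -- Right exactness is applied to the presentation of `M` by the free module on its underlying set.
  have hs : Function.Surjective (Finsupp.linearCombination Rᵐᵒᵖ (id : M → M)) :=
    fun x => ⟨Finsupp.single x 1, by simp⟩
  obtain ⟨y, hy⟩ := exists_of_tensorMap_left_eq_zero (Q := Q) hs
    (z := ∑ i, tmul R (Finsupp.single (m i) (1 : Rᵐᵒᵖ)) (q i))
    (by simpa [map_sum, tensorMap_tmul] using h)
  obtain ⟨L, k, b, rfl⟩ := exists_sum_tmul y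
  exact ⟨L, fun l => k l, b, fun l => (k l).2, by simp [← hy, map_sum, tensorMap_tmul]⟩

/-- A tensor that vanishes in `P ⊗_R Q` vanishes already over each submodule of `P` that
contains a suitable finite set. -/
theorem exists_finite_forall_tensorMap_eq_zero (f : M →ₗ[Rᵐᵒᵖ] M') {z : Tensor R M Q}
    (hz : tensorMap f (LinearMap.id : Q →ₗ[R] Q) z = 0) :
    ∃ X : Set M', X.Finite ∧ ∀ (N : Submodule Rᵐᵒᵖ M') (g : M →ₗ[Rᵐᵒᵖ] N),
      N.subtype ∘ₗ g = f → X ⊆ N → tensorMap g (LinearMap.id : Q →ₗ[R] Q) z = 0 := by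
  classical
  obtain ⟨n, m, q, rfl⟩ := exists_sum_tmul z
  simp only [map_sum, tensorMap_tmul, LinearMap.id_apply] at hz ⊢
  obtain ⟨L, k, b, hk, hb⟩ := exists_relations_of_sum_tmul_eq_zero hz
  refine ⟨⋃ l, (k l).support, Set.finite_iUnion fun l => Finset.finite_toSet _, ?_⟩
  intro N g hg hX
  -- The value `0` outside `N` is never used: the relations `k l` are supported in `X ⊆ N`.
  let Φ : (M' →₀ Rᵐᵒᵖ) →ₗ[Rᵐᵒᵖ] N :=
    Finsupp.linearCombination Rᵐᵒᵖ fun x => if hx : x ∈ N then ⟨x, hx⟩ else 0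
  have hΦ : ∀ i, Φ (Finsupp.single (f (m i)) 1) = g (m i) := fun i => by
    have : f (m i) = g (m i) := by rw [← hg]; rfl
    simp [Φ, this]
  have hΦk : ∀ l, Φ (k l) = 0 := fun l => by
    apply N.subtype_injective
    rw [map_zero, ← hk l, ← LinearMap.comp_apply]
    simp only [Φ, Finsupp.linearCombination_apply, Finsupp.sum, LinearMap.comp_apply, map_sum,
      map_smul]
    refine Finset.sum_congr rfl fun x hx => ?_
    have : x ∈ N := hX (Set.mem_iUnion.2 ⟨l, hx⟩)
    simp [this]
  have := congrArg (tensorMap Φ (LinearMap.id : Q →ₗ[R] Q)) hb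
  simpa [map_sum, tensorMap_tmul, hΦ, hΦk, zero_tmul] using this

/-- The coordinates of an element of `R^n ⊗_R Q ≅ Q^n`. -/
def freeCoord (n : ℕ) (i : Fin n) : Tensor R (Fin n → Rᵐᵒᵖ) Q →ₗ[ℤ] Q :=
  tensorLift
    (AddMonoidHom.mk' (fun v => AddMonoidHom.mk' (fun q => (v i).unop • q) (by simp)) (by
      intro v w; ext q; simp [add_smul]))
    (by intro v r q; simp [mul_smul])

theorem freeCoord_tmul (n : ℕ) (i : Fin n) (v : Fin n → Rᵐᵒᵖ) (q : Q) :
    freeCoord n i (tmul R v q) = (v i).unop • q := rfl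

theorem eq_sum_tmul_freeCoord {n : ℕ} (z : Tensor R (Fin n → Rᵐᵒᵖ) Q) :
    z = ∑ i, tmul R (Pi.single i (1 : Rᵐᵒᵖ)) (freeCoord n i z) := by
  induction z using tensor_induction with
  | zero => simp [tmul_zero]
  | tmul v q =>
    simp only [freeCoord_tmul, ← tmul_balanced, ← sum_tmul, MulOpposite.op_unop]
    congr 1
    ext j
    simp [Finset.sum_apply, Pi.single_apply]
  | add x y hx hy =>
    simp only [map_add, tmul_add, Finset.sum_add_distrib]
    rw [← hx, ← hy]

theorem eq_zero_of_freeCoord_eq_zero {n : ℕ} {z : Tensor R (Fin n → Rᵐᵒᵖ) Q}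
    (h : ∀ i, freeCoord n i z = 0) : z = 0 := by
  rw [eq_sum_tmul_freeCoord z]
  simp [h, tmul_zero]

theorem freeCoord_tensorMap (n : ℕ) (i : Fin n) (g : Q →ₗ[R] Q')
    (z : Tensor R (Fin n → Rᵐᵒᵖ) Q) :
    freeCoord n i (tensorMap LinearMap.id g z) = g (freeCoord n i z) := by
  induction z using tensor_induction with
  | zero => simp
  | tmul v q => simp [tensorMap_tmul, freeCoord_tmul]
  | add x y hx hy => simp [hx, hy]

theorem tensorMap_free_injective (n : ℕ) {g : Q →ₗ[R] Q'} (hg : Function.Injective g) :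
    Function.Injective (tensorMap (LinearMap.id : (Fin n → Rᵐᵒᵖ) →ₗ[Rᵐᵒᵖ] _) g) := by
  refine (injective_iff_map_eq_zero _).2 fun z hz => eq_zero_of_freeCoord_eq_zero fun i => hg ?_
  rw [← freeCoord_tensorMap, hz, map_zero, map_zero]

theorem tensorPi_apply {I : Type*} (P : I → Type*) [∀ i, AddCommGroup (P i)]
    [∀ i, Module R (P i)] (z : Tensor R M (∀ i, P i)) (i : I) :
    tensorPi R M P z i = tensorMap LinearMap.id (LinearMap.proj i) z := rfl

theorem tensorPi_tensorMap {I : Type*} (P : I → Type*) [∀ i, AddCommGroup (P i)]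
    [∀ i, Module R (P i)] (f : M →ₗ[Rᵐᵒᵖ] M') (z : Tensor R M (∀ i, P i)) (i : I) :
    tensorPi R M' P (tensorMap f LinearMap.id z) i =
      tensorMap f LinearMap.id (tensorPi R M P z i) := by
  rw [tensorPi_apply, tensorPi_apply, tensorMap_comm]

theorem tensorPi_free_injective (n : ℕ) {I : Type*} (P : I → Type*) [∀ i, AddCommGroup (P i)]
    [∀ i, Module R (P i)] : Function.Injective (tensorPi R (Fin n → Rᵐᵒᵖ) P) := by
  refine (injective_iff_map_eq_zero _).2 fun z hz => eq_zero_of_freeCoord_eq_zero fun k => ?_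
  ext i
  have := congrFun hz i
  rw [tensorPi_apply] at this
  change LinearMap.proj (R := R) i (freeCoord n k z) = 0
  rw [← freeCoord_tensorMap, this, Pi.zero_apply, map_zero]

end TensorCalculus

/-! ### The equational criterion for flatness. -/

section Flat

variable {R : Type u} [Ring R] {M : Type u} [AddCommGroup M] [Module Rᵐᵒᵖ M]

/-- The map `m ⊗ v ↦ m · v i` from `M ⊗_R R^n` to `M`. -/
def rightCoord (n : ℕ) (i : Fin n) : Tensor R M (Fin n → R) →ₗ[ℤ] M :=
  tensorLift
    (AddMonoidHom.mk' (fun m => AddMonoidHom.mk' (fun v => MulOpposite.op (v i) • m) (by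
      simp [add_smul])) (by intro v w; ext q; simp))
    (by intro v r q; simp [mul_smul])

theorem rightCoord_tmul (n : ℕ) (i : Fin n) (m : M) (v : Fin n → R) :
    rightCoord n i (tmul R m v) = MulOpposite.op (v i) • m := rfl

/-- The equational criterion for vanishing over a flat module. -/
theorem IsFlat.exists_factorization (hM : IsFlat R M) {Q : Type u} [AddCommGroup Q] [Module R Q]
    {p : ℕ} {m : Fin p → M} {q : Fin p → Q} (h : ∑ i, tmul R (m i) (q i) = 0) :
    ∃ (n : ℕ) (r : Fin n → Fin p → R) (b : Fin n → M),
      (∀ i, m i = ∑ k, MulOpposite.op (r k i) • b k) ∧ ∀ k, ∑ i, r k i • q i = 0 := by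
  classical
  let g : (Fin p → R) →ₗ[R] Q := Fintype.linearCombination R q
  have hg : ∀ v, g v = ∑ i, v i • q i := fun v => Fintype.linearCombination_apply R q v
  let z : Tensor R M (Fin p → R) := ∑ i, tmul R (m i) (Pi.single i 1)
  -- By flatness, `z` already vanishes over the range of `g`; right exactness then lifts it to the
  -- kernel, whose elements are linear relations among the `q i`.
  have hz : tensorMap LinearMap.id g.rangeRestrict z = 0 := by
    refine hM _ _ (LinearMap.range g).subtype Subtype.val_injective ?_
    rw [tensorMap_tensorMap, map_zero]
    simp only [z, map_sum, tensorMap_tmul]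
    rw [← h]
    refine Finset.sum_congr rfl fun i _ => ?_
    simp [hg, Pi.single_apply]
  obtain ⟨y, hy⟩ := exists_of_tensorMap_right_eq_zero g.surjective_rangeRestrict hz
  obtain ⟨n, b, r, rfl⟩ := exists_sum_tmul y
  refine ⟨n, fun k => (r k : Fin p → R), b, fun i => ?_, fun k => ?_⟩
  · have := congrArg (rightCoord p i) hy
    simp only [z, map_sum, tensorMap_tmul, rightCoord_tmul] at this
    simpa [Pi.single_apply, apply_ite MulOpposite.op, ite_smul] using this.symm
  · rw [← hg]
    exact congrArg Subtype.val (LinearMap.mem_ker.1 (r k).2)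

end Flat

/-! ### Descent to pure submodules. -/

section Pure

variable {R : Type u} [Ring R]
variable {M : Type u} [AddCommGroup M] [Module Rᵐᵒᵖ M]
variable {N : Type u} [AddCommGroup N] [Module Rᵐᵒᵖ N]

theorem IsFlat.of_pure (hM : IsFlat R M) (f : N →ₗ[Rᵐᵒᵖ] M)
    (hf : ∀ (A : Type u) [AddCommGroup A] [Module R A],
      Function.Injective (tensorMap f (LinearMap.id : A →ₗ[R] A))) : IsFlat R N := by
  intro A B _ _ _ _ g hg
  refine (injective_iff_map_eq_zero _).2 fun z hz => ?_
  refine (map_eq_zero_iff _ (hf A)).1 ((map_eq_zero_iff _ (hM A B g hg)).1 ?_)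
  rw [tensorMap_comm, hz, map_zero]

theorem IsMittagLeffler.of_pure {𝒬 : Set (ModuleCat.{u} R)} (hM : IsMittagLeffler R M 𝒬)
    (f : N →ₗ[Rᵐᵒᵖ] M)
    (hf : ∀ (A : Type u) [AddCommGroup A] [Module R A],
      Function.Injective (tensorMap f (LinearMap.id : A →ₗ[R] A))) : IsMittagLeffler R N 𝒬 := by
  intro I Q hQ
  refine (injective_iff_map_eq_zero _).2 fun z hz => ?_
  refine (map_eq_zero_iff _ (hf _)).1 ((map_eq_zero_iff _ (hM I Q hQ)).1 ?_)
  ext1 i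
  rw [tensorPi_tensorMap, hz, Pi.zero_apply, map_zero, Pi.zero_apply]

theorem tensorMap_subtype_inclusion {N N' : Submodule Rᵐᵒᵖ M} (h : N ≤ N') {A : Type u}
    [AddCommGroup A] [Module R A] (z : Tensor R N A) :
    tensorMap N'.subtype (LinearMap.id : A →ₗ[R] A)
      (tensorMap (Submodule.inclusion h) LinearMap.id z) =
        tensorMap N.subtype LinearMap.id z := by
  rw [tensorMap_tensorMap]; rfl

theorem tensorMap_inclusion_inclusion {N N' N'' : Submodule Rᵐᵒᵖ M} (h : N ≤ N') (h' : N' ≤ N'')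
    {A : Type u} [AddCommGroup A] [Module R A] (z : Tensor R N A) :
    tensorMap (Submodule.inclusion h') (LinearMap.id : A →ₗ[R] A)
      (tensorMap (Submodule.inclusion h) LinearMap.id z) =
        tensorMap (Submodule.inclusion (h.trans h')) LinearMap.id z := by
  rw [tensorMap_tensorMap]; rfl

theorem StaysInjective.inclusion {N N' : Submodule Rᵐᵒᵖ M} {A : Type u} [AddCommGroup A]
    [Module R A] (hN : StaysInjective R N A) (h : N ≤ N') :
    Function.Injective (tensorMap (Submodule.inclusion h) (LinearMap.id : A →ₗ[R] A)) := by
  refine fun x y hxy => hN ?_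
  rw [← tensorMap_subtype_inclusion h, hxy, tensorMap_subtype_inclusion h]

theorem IsFlat.of_le_of_pure {N N' : Submodule Rᵐᵒᵖ M} (h : N ≤ N') (hN : IsPureSubmodule R N)
    (hN' : IsFlat R N') : IsFlat R N :=
  hN'.of_pure (Submodule.inclusion h) fun A _ _ => (hN A).inclusion h

theorem IsMittagLeffler.of_le_of_pure {𝒬 : Set (ModuleCat.{u} R)} {N N' : Submodule Rᵐᵒᵖ M}
    (h : N ≤ N') (hN : IsPureSubmodule R N) (hN' : IsMittagLeffler R N' 𝒬) :
    IsMittagLeffler R N 𝒬 :=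
  hN'.of_pure (Submodule.inclusion h) fun A _ _ => (hN A).inclusion h

end Pure

/-! ### Directed unions of submodules. -/

section Directed

variable {R : Type u} [Ring R]
variable {M : Type u} [AddCommGroup M] [Module Rᵐᵒᵖ M]
variable {ι : Type*} [Nonempty ι] {N : ι → Submodule Rᵐᵒᵖ M}

theorem exists_subset_of_directed (hN : Directed (· ≤ ·) N) {X : Set M} (hX : X.Finite)
    (h : X ⊆ (⨆ i, N i : Submodule Rᵐᵒᵖ M)) : ∃ i, X ⊆ N i := by
  have := Directed.exists_mem_subset_of_finset_subset_biUnion (f := fun i => (N i : Set M))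
    hN (s := hX.toFinset) (by rwa [hX.coe_toFinset, ← Submodule.coe_iSup_of_directed N hN])
  simpa using this

theorem exists_tensorMap_inclusion_eq (hN : Directed (· ≤ ·) N) {A : Type u} [AddCommGroup A]
    [Module R A] (z : Tensor R (⨆ i, N i : Submodule Rᵐᵒᵖ M) A) :
    ∃ i, ∃ y : Tensor R (N i) A,
      tensorMap (Submodule.inclusion (le_iSup N i)) LinearMap.id y = z := by
  obtain ⟨n, m, a, rfl⟩ := exists_sum_tmul z
  obtain ⟨i, hi⟩ := exists_subset_of_directed hN (Set.finite_range fun k => (m k : M))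
    (by rintro _ ⟨k, rfl⟩; exact (m k).2)
  refine ⟨i, ∑ k, tmul R (⟨m k, hi ⟨k, rfl⟩⟩ : N i) (a k), ?_⟩
  simp only [map_sum, tensorMap_tmul]
  rfl

theorem exists_tensorMap_inclusion_eq_zero (hN : Directed (· ≤ ·) N) {A : Type u}
    [AddCommGroup A] [Module R A] {P : Submodule Rᵐᵒᵖ M} {i : ι} (hi : P ≤ N i)
    {z : Tensor R P A}
    (hz : tensorMap (Submodule.inclusion (hi.trans (le_iSup N i))) (LinearMap.id : A →ₗ[R] A) z
      = 0) :
    ∃ j, ∃ hj : P ≤ N j, N i ≤ N j ∧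
      tensorMap (Submodule.inclusion hj) (LinearMap.id : A →ₗ[R] A) z = 0 := by
  obtain ⟨X, hX, h⟩ := exists_finite_forall_tensorMap_eq_zero _ hz
  obtain ⟨j, hj⟩ := exists_subset_of_directed hN (hX.image Subtype.val)
    (by rintro _ ⟨k, -, rfl⟩; exact k.2)
  obtain ⟨k, hik, hjk⟩ := hN i j
  refine ⟨k, hi.trans hik, hik, ?_⟩
  have h1 := h ((N k).comap (⨆ i, N i).subtype)
    ((Submodule.inclusion (hi.trans (le_iSup N i))).codRestrict _ fun x => hik (hi x.2)) rfl
    fun x hx => hjk (hj ⟨x, hx, rfl⟩)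
  -- `h1` holds over a submodule of the union; `e` moves it to `N k` itself.
  let e : (N k).comap (⨆ i, N i).subtype →ₗ[Rᵐᵒᵖ] N k :=
    ((⨆ i, N i).subtype.comp (Submodule.subtype _)).codRestrict _ fun x => x.2
  have h2 := congrArg (tensorMap e (LinearMap.id : A →ₗ[R] A)) h1
  rwa [tensorMap_tensorMap, map_zero] at h2

/-- A tensor over the union, and the vanishing of its image, are both witnessed at a single stage.
-/
theorem isFlat_iSup (hN : Directed (· ≤ ·) N) (h : ∀ i, IsFlat R (N i)) :
    IsFlat R (⨆ i, N i : Submodule Rᵐᵒᵖ M) := by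
  intro A B _ _ _ _ g hg
  refine (injective_iff_map_eq_zero _).2 fun z hz => ?_
  obtain ⟨i, y, rfl⟩ := exists_tensorMap_inclusion_eq hN z
  rw [tensorMap_comm] at hz
  obtain ⟨j, hj, -, h0⟩ := exists_tensorMap_inclusion_eq_zero hN le_rfl hz
  rw [← tensorMap_comm] at h0
  rw [← tensorMap_inclusion_inclusion hj (le_iSup N j),
    (map_eq_zero_iff _ (h j A B g hg)).1 h0, map_zero]

theorem staysInjective_iSup (hN : Directed (· ≤ ·) N) {A : Type u} [AddCommGroup A]
    [Module R A] (h : ∀ i, StaysInjective R (N i) A) :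
    StaysInjective R (⨆ i, N i : Submodule Rᵐᵒᵖ M) A := by
  refine (injective_iff_map_eq_zero _).2 fun z hz => ?_
  obtain ⟨i, y, rfl⟩ := exists_tensorMap_inclusion_eq hN z
  rw [tensorMap_subtype_inclusion] at hz
  rw [(map_eq_zero_iff _ (h i)).1 hz, map_zero]

/-- Since each stage embeds into the union after tensoring with members of `𝒬`, coordinates that
vanish over the union vanish already at the stage where the tensor lives. -/
theorem isMittagLeffler_iSup_of_staysInjective {𝒬 : Set (ModuleCat.{u} R)}
    (hN : Directed (· ≤ ·) N) (h : ∀ i, IsMittagLeffler R (N i) 𝒬)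
    (h' : ∀ i, ∀ Q ∈ 𝒬, StaysInjective R (N i) Q) :
    IsMittagLeffler R (⨆ i, N i : Submodule Rᵐᵒᵖ M) 𝒬 := by
  intro I Q hQ
  refine (injective_iff_map_eq_zero _).2 fun z hz => ?_
  obtain ⟨i, y, rfl⟩ := exists_tensorMap_inclusion_eq hN z
  suffices y = 0 by rw [this, map_zero]
  refine (map_eq_zero_iff _ (h i I Q hQ)).1 ?_
  ext1 k
  refine (map_eq_zero_iff _ ((h' i (Q k) (hQ k)).inclusion (le_iSup N i))).1 ?_
  exact (tensorPi_tensorMap (fun i => Q i) _ y k).symm.trans (congrFun hz k)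

theorem isFlat_of_top (h : IsFlat R (⊤ : Submodule Rᵐᵒᵖ M)) : IsFlat R M :=
  h.of_pure (Submodule.topEquiv (R := Rᵐᵒᵖ) (M := M)).symm.toLinearMap fun A _ _ =>
    Function.LeftInverse.injective
      (g := tensorMap (Submodule.topEquiv (R := Rᵐᵒᵖ) (M := M)).toLinearMap LinearMap.id)
      fun z => by rw [tensorMap_tensorMap]; exact tensorMap_id_id z

theorem isMittagLeffler_of_top {𝒬 : Set (ModuleCat.{u} R)}
    (h : IsMittagLeffler R (⊤ : Submodule Rᵐᵒᵖ M) 𝒬) : IsMittagLeffler R M 𝒬 :=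
  h.of_pure (Submodule.topEquiv (R := Rᵐᵒᵖ) (M := M)).symm.toLinearMap fun A _ _ =>
    Function.LeftInverse.injective
      (g := tensorMap (Submodule.topEquiv (R := Rᵐᵒᵖ) (M := M)).toLinearMap LinearMap.id)
      fun z => by rw [tensorMap_tensorMap]; exact tensorMap_id_id z

/-- The union of a directed system of `𝒬`-Mittag-Leffler submodules that is closed under unions
of countable chains is `𝒬`-Mittag-Leffler. -/
theorem isMittagLeffler_sSup {𝒬 : Set (ModuleCat.{u} R)} {𝒯 : Set (Submodule Rᵐᵒᵖ M)}
    [Nonempty 𝒯] (hdir : DirectedOn (· ≤ ·) 𝒯) (hML : ∀ N ∈ 𝒯, IsMittagLeffler R N 𝒬)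
    (hchain : ClosedUnderCountableChains 𝒯) :
    IsMittagLeffler R (⨆ N : 𝒯, (N : Submodule Rᵐᵒᵖ M) : Submodule Rᵐᵒᵖ M) 𝒬 := by
  intro I Q hQ
  refine (injective_iff_map_eq_zero _).2 fun z hz => ?_
  have hN : Directed (· ≤ ·) fun N : 𝒯 => (N : Submodule Rᵐᵒᵖ M) := hdir.directed_val
  obtain ⟨N₀, y, rfl⟩ := exists_tensorMap_inclusion_eq hN z
  by_contra hne
  -- The image of `y` in each such `N` is nonzero, so the Mittag-Leffler property of `N` exhibits a
  -- live coordinate `i`; it dies in the union, hence in some larger `N'`.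
  have step : ∀ N : {N : 𝒯 // (N₀ : Submodule Rᵐᵒᵖ M) ≤ N},
      ∃ (i : I) (N' : {N : 𝒯 // (N₀ : Submodule Rᵐᵒᵖ M) ≤ N}),
        (N.1 : Submodule Rᵐᵒᵖ M) ≤ N'.1 ∧
        tensorMap (Submodule.inclusion N.2) LinearMap.id
          (tensorPi R N₀ (fun i => Q i) y i) ≠ 0 ∧
        tensorMap (Submodule.inclusion N'.2) LinearMap.id
          (tensorPi R N₀ (fun i => Q i) y i) = 0 := fun N => by
    have h1 : tensorPi R N.1 (fun i => Q i)
        (tensorMap (Submodule.inclusion N.2) LinearMap.id y) ≠ 0 := fun h0 => by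
      apply hne
      rw [← tensorMap_inclusion_inclusion N.2 (le_iSup (fun N : 𝒯 => (N : Submodule Rᵐᵒᵖ M)) N.1),
        (map_eq_zero_iff _ (hML _ N.1.2 I Q hQ)).1 h0, map_zero]
    obtain ⟨i, hi⟩ := Function.ne_iff.1 h1
    rw [tensorPi_tensorMap] at hi
    have h2 : tensorMap
        (Submodule.inclusion (N.2.trans (le_iSup (fun N : 𝒯 => (N : Submodule Rᵐᵒᵖ M)) N.1)))
        LinearMap.id (tensorPi R N₀ (fun i => Q i) y i) = 0 :=
      (tensorPi_tensorMap (fun i => Q i) _ y i).symm.trans (congrFun hz i)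
    obtain ⟨N', hN', hle, h0⟩ := exists_tensorMap_inclusion_eq_zero hN N.2 h2
    exact ⟨i, ⟨N', hN'⟩, hle, hi, h0⟩
  choose idx nxt hle hnz hz0 using step
  let seq : ℕ → {N : 𝒯 // (N₀ : Submodule Rᵐᵒᵖ M) ≤ N} := fun k => nxt^[k] ⟨N₀, le_rfl⟩
  have hseq : ∀ k, seq (k + 1) = nxt (seq k) := fun k => Function.iterate_succ_apply' _ _ _
  have hmono : Monotone fun k => ((seq k).1 : Submodule Rᵐᵒᵖ M) :=
    monotone_nat_of_le_succ fun k => by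
      rw [hseq]; exact hle _
  have hmem := hchain _ hmono fun k => (seq k).1.2
  -- Only the coordinates selected along the chain are kept, with repetitions allowed; each of them
  -- vanishes over the union of the chain.
  let Q' : ULift.{u} ℕ → ModuleCat.{u} R := fun k => Q (idx (seq k.down))
  let ρ : (∀ i, Q i) →ₗ[R] ∀ k, Q' k := LinearMap.pi fun k => LinearMap.proj (idx (seq k.down))
  let w : Tensor R N₀ (∀ k, Q' k) := tensorMap LinearMap.id ρ y
  have hw : ∀ k, tensorPi R N₀ (fun k => Q' k) w k =
      tensorPi R N₀ (fun i => Q i) y (idx (seq k.down)) := fun k => by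
    simp only [w, tensorPi_apply, tensorMap_tensorMap]
    rfl
  have hle0 : ∀ k, (N₀ : Submodule Rᵐᵒᵖ M) ≤ (seq k).1 := fun k => (seq k).2
  have hsup : ∀ k, ((seq k).1 : Submodule Rᵐᵒᵖ M) ≤ ⨆ k, ((seq k).1 : Submodule Rᵐᵒᵖ M) :=
    fun k => le_iSup (fun k => ((seq k).1 : Submodule Rᵐᵒᵖ M)) k
  have hw0 : tensorMap (Submodule.inclusion ((hle0 0).trans (hsup 0))) LinearMap.id w = 0 := by
    refine (map_eq_zero_iff _ (hML _ hmem _ Q' fun k => hQ _)).1 ?_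
    ext1 k
    rw [tensorPi_tensorMap, hw, Pi.zero_apply,
      ← tensorMap_inclusion_inclusion (hle0 (k.down + 1)) (hsup (k.down + 1))]
    have : ∀ (N : {N : 𝒯 // (N₀ : Submodule Rᵐᵒᵖ M) ≤ N}), N = nxt (seq k.down) →
        tensorMap (Submodule.inclusion N.2) LinearMap.id
          (tensorPi R N₀ (fun i => Q i) y (idx (seq k.down))) = 0 := by
      rintro _ rfl; exact hz0 _
    rw [this _ (hseq _), map_zero]
  -- `w` now vanishes at a finite stage `k`, although its `k`-th coordinate is nonzero there.
  obtain ⟨k, hk, -, h0⟩ := exists_tensorMap_inclusion_eq_zero hmono.directed_le (hle0 0) hw0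
  apply hnz (seq k)
  rw [← hw ⟨k⟩]
  exact (tensorPi_tensorMap (fun k => Q' k) _ w ⟨k⟩).symm.trans (by rw [h0, map_zero]; rfl)

end Directed

theorem isFlat_and_isMittagLeffler_of_directedOn {R : Type u} [Ring R] {M : Type u}
    [AddCommGroup M] [Module Rᵐᵒᵖ M] {𝒬 : Set (ModuleCat.{u} R)} {𝒯 : Set (Submodule Rᵐᵒᵖ M)}
    (h : ∀ N ∈ 𝒯, IsFlat R N ∧ IsMittagLeffler R N 𝒬) (hdir : DirectedOn (· ≤ ·) 𝒯)
    (hU : (⋃ N ∈ 𝒯, (N : Set M)) = Set.univ) (hchain : ClosedUnderCountableChains 𝒯) :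
    IsFlat R M ∧ IsMittagLeffler R M 𝒬 := by
  have hmem : ∀ x : M, ∃ N ∈ 𝒯, x ∈ N := fun x => by
    have : x ∈ ⋃ N ∈ 𝒯, (N : Set M) := hU ▸ Set.mem_univ x
    simpa using this
  obtain ⟨N₀, hN₀, -⟩ := hmem 0
  have : Nonempty 𝒯 := ⟨⟨N₀, hN₀⟩⟩
  have htop : (⨆ N : 𝒯, (N : Submodule Rᵐᵒᵖ M)) = ⊤ := by
    refine eq_top_iff.2 fun x _ => ?_
    obtain ⟨N, hN, hx⟩ := hmem x
    exact le_iSup (fun N : 𝒯 => (N : Submodule Rᵐᵒᵖ M)) ⟨N, hN⟩ hx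
  have h1 := isFlat_iSup hdir.directed_val fun N : 𝒯 => (h N N.2).1
  have h2 := isMittagLeffler_sSup hdir (fun N hN => (h N hN).2) hchain
  rw [htop] at h1 h2
  exact ⟨isFlat_of_top h1, isMittagLeffler_of_top h2⟩

/-! ### Small pure submodules by a Löwenheim–Skolem argument. -/

section LowenheimSkolem

variable {R : Type u} [Ring R]
variable {M : Type u} [AddCommGroup M] [Module Rᵐᵒᵖ M]

/-- The sequence `x` solves the finite system `e` of linear equations with right-hand sides
in `M`. -/
def IsSolution (e : List ((ℕ →₀ Rᵐᵒᵖ) × M)) (x : ℕ → M) : Prop :=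
  ∀ p ∈ e, Finsupp.linearCombination Rᵐᵒᵖ x p.1 = p.2

/-- A vanishing tensor in `M ⊗ A` rests on finitely many linear relations in `M`. Read the elements
involved as unknowns, with those coming from `N` prescribed: a solution in `N` carries the same
relations into `N`. -/
theorem isPureSubmodule_of_forall_isSolution {N : Submodule Rᵐᵒᵖ M}
    (h : ∀ e : List ((ℕ →₀ Rᵐᵒᵖ) × M), (∀ p ∈ e, p.2 ∈ N) → (∃ x, IsSolution e x) →
      ∃ x, IsSolution e x ∧ ∀ k, x k ∈ N) : IsPureSubmodule R N := by
  classical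
  intro A _ _
  refine (injective_iff_map_eq_zero _).2 fun z hz => ?_
  obtain ⟨n, m, q, rfl⟩ := exists_sum_tmul z
  simp only [map_sum, tensorMap_tmul, LinearMap.id_apply] at hz
  obtain ⟨L, k, b, hk, hb⟩ := exists_relations_of_sum_tmul_eq_zero hz
  let X : Set M := (⋃ l, ((k l).support : Set M)) ∪ Set.range fun i => (m i : M)
  have hX : X.Finite :=
    (Set.finite_iUnion fun l => Finset.finite_toSet _).union (Set.finite_range _)
  -- `ε` numbers the elements of `X`, which become the unknowns.
  obtain ⟨ε, hε⟩ := Set.countable_iff_exists_injOn.1 hX.countable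
  let e : List ((ℕ →₀ Rᵐᵒᵖ) × M) :=
    List.ofFn (fun l => ((k l).mapDomain ε, (0 : M))) ++
      List.ofFn fun i => (Finsupp.single (ε (m i)) 1, (m i : M))
  have he : ∀ x, IsSolution e x ↔
      (∀ l, Finsupp.linearCombination Rᵐᵒᵖ (x ∘ ε) (k l) = 0) ∧
        ∀ i, x (ε (m i)) = m i := fun x => by
    simp only [IsSolution, e, List.mem_append, List.mem_ofFn', Set.mem_range, or_imp,
      forall_and, forall_exists_index, forall_apply_eq_imp_iff, Finsupp.linearCombination_mapDomain,
      Finsupp.linearCombination_single, one_smul]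
  obtain ⟨x, hx, hxN⟩ := h e
    (by
      simp only [e, List.mem_append, List.mem_ofFn', Set.mem_range]
      rintro _ (⟨l, rfl⟩ | ⟨i, rfl⟩)
      exacts [N.zero_mem, (m i).2])
    -- In `M` the system is solved by the elements of `X` themselves.
    ⟨Function.invFunOn ε X, by
      have hinv : ∀ y ∈ X, Function.invFunOn ε X (ε y) = y := fun y hy =>
        hε.leftInvOn_invFunOn hy
      refine (he _).2 ⟨fun l => ?_, fun i => hinv _ (Or.inr ⟨i, rfl⟩)⟩
      rw [← hk l, Finsupp.linearCombination_apply, Finsupp.linearCombination_apply]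
      refine Finset.sum_congr rfl fun y hy => ?_
      simp only [Function.comp_apply, hinv y (Or.inl (Set.mem_iUnion.2 ⟨l, hy⟩)), id]⟩
  obtain ⟨hx1, hx2⟩ := (he x).1 hx
  let Φ : (M →₀ Rᵐᵒᵖ) →ₗ[Rᵐᵒᵖ] N :=
    Finsupp.linearCombination Rᵐᵒᵖ fun y => ⟨x (ε y), hxN _⟩
  have hΦ : ∀ i, Φ (Finsupp.single (m i : M) 1) = m i := fun i => by
    simp [Φ, hx2]
  have hΦk : ∀ l, Φ (k l) = 0 := fun l => by
    apply N.subtype_injective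
    rw [map_zero, ← hx1 l]
    simp [Φ, Finsupp.linearCombination_apply, Finsupp.sum, map_sum]
  have := congrArg (tensorMap Φ (LinearMap.id : A →ₗ[R] A)) hb
  simpa [map_sum, tensorMap_tmul, hΦ, hΦk, zero_tmul] using this

open Classical in
/-- A chosen solution of each solvable system. -/
noncomputable def chosenSolution (e : List ((ℕ →₀ Rᵐᵒᵖ) × M)) : ℕ → M :=
  if h : ∃ x, IsSolution e x then h.choose else 0

theorem isSolution_chosenSolution {e : List ((ℕ →₀ Rᵐᵒᵖ) × M)} (h : ∃ x, IsSolution e x) :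
    IsSolution e (chosenSolution e) := by
  rw [chosenSolution, dif_pos h]
  exact h.choose_spec

/-- The submodule obtained from `N` by adjoining the chosen solutions of all systems with
right-hand sides in `N`. -/
noncomputable def adjoinSolutions (N : Submodule Rᵐᵒᵖ M) : Submodule Rᵐᵒᵖ M :=
  Submodule.span Rᵐᵒᵖ (N ∪ Set.range fun p : List ((ℕ →₀ Rᵐᵒᵖ) × N) × ℕ =>
    chosenSolution (p.1.map (Prod.map id Subtype.val)) p.2)

theorem le_adjoinSolutions (N : Submodule Rᵐᵒᵖ M) : N ≤ adjoinSolutions N :=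
  fun _ hx => Submodule.subset_span (Or.inl hx)

theorem chosenSolution_mem_adjoinSolutions {N : Submodule Rᵐᵒᵖ M}
    {e : List ((ℕ →₀ Rᵐᵒᵖ) × M)} (he : ∀ p ∈ e, p.2 ∈ N) (k : ℕ) :
    chosenSolution e k ∈ adjoinSolutions N := by
  refine Submodule.subset_span (Or.inr
    ⟨(e.attach.map fun p => (p.1.1, ⟨p.1.2, he p.1 p.2⟩), k), ?_⟩)
  have : (e.attach.map fun p => (p.1.1, (⟨p.1.2, he p.1 p.2⟩ : N))).map
      (Prod.map id Subtype.val) = e := by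
    rw [List.map_map]
    exact e.attach_map_subtype_val
  simp only [this]

theorem mk_finsupp_le_of_le {α : Type*} {β : Type u} [Zero β] {κ : Cardinal.{u}} (h0 : ℵ₀ ≤ κ)
    (hα : Cardinal.lift.{u} #α ≤ Cardinal.lift κ) (hβ : #β ≤ κ) :
    #(α →₀ β) ≤ Cardinal.lift κ := by
  classical
  have h0' : ℵ₀ ≤ Cardinal.lift κ := Cardinal.aleph0_le_lift.2 h0
  refine (Cardinal.mk_le_of_injective (Finsupp.graph_injective α β)).trans ?_
  refine (Cardinal.mk_le_of_surjective (f := List.toFinset) List.toFinset_surjective).trans ?_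
  refine (Cardinal.mk_list_le_max _).trans (max_le h0' ?_)
  rw [Cardinal.mk_prod]
  exact Cardinal.mul_le_of_le h0' hα (Cardinal.lift_le.2 hβ)

theorem mk_span_le {κ : Cardinal.{u}} (h0 : ℵ₀ ≤ κ) (hR : #R ≤ κ) {X : Set M} (hX : #X ≤ κ) :
    #(Submodule.span Rᵐᵒᵖ X) ≤ κ := by
  have hR' : #Rᵐᵒᵖ ≤ κ := (Cardinal.mk_congr MulOpposite.opEquiv.symm).trans_le hR
  have h1 : #(X →₀ Rᵐᵒᵖ) ≤ κ := by
    simpa using mk_finsupp_le_of_le (α := X) (β := Rᵐᵒᵖ) h0 (by simpa using hX) hR'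
  have : Submodule.span Rᵐᵒᵖ X =
      LinearMap.range (Finsupp.linearCombination Rᵐᵒᵖ (Subtype.val : X → M)) := by
    rw [Finsupp.range_linearCombination, Subtype.range_coe]
  rw [this]
  exact (Cardinal.mk_range_le
    (f := Finsupp.linearCombination Rᵐᵒᵖ (Subtype.val : X → M))).trans h1

theorem mk_adjoinSolutions_le {κ : Cardinal.{u}} (h0 : ℵ₀ ≤ κ) (hR : #R ≤ κ)
    {N : Submodule Rᵐᵒᵖ M} (hN : #N ≤ κ) : #(adjoinSolutions N) ≤ κ := by
  have hR' : #Rᵐᵒᵖ ≤ κ := (Cardinal.mk_congr MulOpposite.opEquiv.symm).trans_le hR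
  refine mk_span_le h0 hR ((Cardinal.mk_union_le _ _).trans ?_)
  refine Cardinal.add_le_of_le h0 hN (Cardinal.mk_range_le.trans ?_)
  have h1 : #(ℕ →₀ Rᵐᵒᵖ) ≤ κ := by
    simpa using mk_finsupp_le_of_le (α := ℕ) (β := Rᵐᵒᵖ) h0 (by simpa using h0) hR'
  have h2 : #(List ((ℕ →₀ Rᵐᵒᵖ) × N)) ≤ κ := by
    refine (Cardinal.mk_list_le_max _).trans (max_le h0 ?_)
    rw [Cardinal.mk_prod, Cardinal.lift_id, Cardinal.lift_id]
    exact Cardinal.mul_le_of_le h0 h1 hN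
  rw [Cardinal.mk_prod]
  exact Cardinal.mul_le_of_le h0 (by simpa using h2) (by simpa using h0)

theorem mk_iSup_le {κ : Cardinal.{u}} (h0 : ℵ₀ ≤ κ) {ι : Type u} [Nonempty ι] (hι : #ι ≤ κ)
    {N : ι → Submodule Rᵐᵒᵖ M} (hdir : Directed (· ≤ ·) N) (hN : ∀ i, #(N i) ≤ κ) :
    #(⨆ i, N i : Submodule Rᵐᵒᵖ M) ≤ κ := by
  change #((⨆ i, N i : Submodule Rᵐᵒᵖ M) : Set M) ≤ κ
  rw [Submodule.coe_iSup_of_directed N hdir]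
  refine (Cardinal.mk_iUnion_le _).trans (Cardinal.mul_le_of_le h0 hι (ciSup_le' hN))

/-- Each subset of `M` of cardinality at most `κ ≥ |R| + ℵ₀` is contained in a pure submodule of
cardinality at most `κ`. -/
theorem exists_isPureSubmodule {κ : Cardinal.{u}} (h0 : ℵ₀ ≤ κ) (hR : #R ≤ κ) {C : Set M}
    (hC : #C ≤ κ) : ∃ N : Submodule Rᵐᵒᵖ M, IsPureSubmodule R N ∧ C ⊆ N ∧ #N ≤ κ := by
  let seq : ℕ → Submodule Rᵐᵒᵖ M := fun k => adjoinSolutions^[k] (Submodule.span Rᵐᵒᵖ C)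
  have hseq : ∀ k, seq (k + 1) = adjoinSolutions (seq k) := fun k =>
    Function.iterate_succ_apply' _ _ _
  have hmono : Monotone seq := monotone_nat_of_le_succ fun k => by
    rw [hseq]; exact le_adjoinSolutions _
  have hcard : ∀ k, #(seq k) ≤ κ := fun k => by
    induction k with
    | zero => exact mk_span_le h0 hR hC
    | succ k ih => rw [hseq]; exact mk_adjoinSolutions_le h0 hR ih
  refine ⟨⨆ k, seq k, ?_, ?_, ?_⟩
  · refine isPureSubmodule_of_forall_isSolution fun e he hx => ?_
    -- The finitely many right-hand sides lie in one stage `i`, so the chosen solution lies in stage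
    -- `i + 1`.
    obtain ⟨i, hi⟩ := exists_subset_of_directed hmono.directed_le
      (X := {y | ∃ p ∈ e, p.2 = y}) (by
        refine (e.map Prod.snd).finite_toSet.subset ?_
        rintro _ ⟨p, hp, rfl⟩
        exact List.mem_map_of_mem hp)
      (by rintro _ ⟨p, hp, rfl⟩; exact he p hp)
    refine ⟨chosenSolution e, isSolution_chosenSolution hx, fun k => ?_⟩
    refine le_iSup seq (i + 1) ?_
    rw [hseq]
    exact chosenSolution_mem_adjoinSolutions (fun p hp => hi ⟨p, hp, rfl⟩) k
  · exact Submodule.subset_span.trans (le_iSup seq 0)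
  · have : ⨆ k, seq k = ⨆ k : ULift.{u} ℕ, seq k.down :=
      (Equiv.ulift.{u, 0} (α := ℕ)).iSup_congr (fun _ => rfl) |>.symm
    rw [this]
    exact mk_iSup_le h0 (by simpa using h0)
      (Monotone.directed_le fun a b (h : a.down ≤ b.down) => hmono h) fun k => hcard _

end LowenheimSkolem

/-! ### Well-ordered and countable chains. -/

section Chains

variable {R : Type u} [Ring R]
variable {M : Type u} [AddCommGroup M] [Module Rᵐᵒᵖ M]

theorem mk_iSup_Iio_le {κ : Cardinal.{u}} (h0 : ℵ₀ ≤ κ) {σ : Ordinal.{u}} (hσ0 : 0 < σ)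
    (hσ : σ ≤ κ.ord) {N : Set.Iio σ → Submodule Rᵐᵒᵖ M} (hmono : Monotone N)
    (hN : ∀ i, #(N i) ≤ κ) : #(⨆ i, N i : Submodule Rᵐᵒᵖ M) ≤ κ := by
  have : ⨆ i, N i = ⨆ k : σ.ToType, N (Ordinal.ToType.mk.symm k) :=
    (Ordinal.ToType.mk (o := σ)).symm.toEquiv.iSup_congr (fun _ => rfl) |>.symm
  rw [this]
  have : Nonempty σ.ToType := ⟨Ordinal.ToType.mk ⟨0, hσ0⟩⟩
  refine mk_iSup_le h0 ?_ (Monotone.directed_le fun a b h => hmono ?_) fun k => hN _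
  · rw [Cardinal.mk_toType]
    exact (Ordinal.card_le_card hσ).trans_eq (Cardinal.card_ord κ)
  · exact Ordinal.ToType.mk.symm.monotone h

/-- As `ℵ₀ ≤ κ`, the length `ω` is allowed, and the ordinals below `ω` are the natural numbers. -/
theorem ClosedUnderChains.closedUnderCountableChains {κ : Cardinal.{u}} (h0 : ℵ₀ ≤ κ)
    {𝒮 : Set (Submodule Rᵐᵒᵖ M)} (h : ClosedUnderChains κ 𝒮) :
    ClosedUnderCountableChains 𝒮 := by
  intro N hmono hN
  choose f hf using fun α : Set.Iio (Ordinal.omega0.{u}) => Ordinal.lt_omega0.1 α.2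
  have hfn : ∀ n : ℕ, f ⟨n, Ordinal.natCast_lt_omega0 n⟩ = n := fun n =>
    (Nat.cast_injective (R := Ordinal.{u}) (hf ⟨n, Ordinal.natCast_lt_omega0 n⟩)).symm
  have key := h Ordinal.omega0 Ordinal.omega0_pos (Cardinal.omega0_le_ord.2 h0)
    (fun α => N (f α)) (fun a b hab => hmono ?_) fun α => hN _
  · convert key using 1
    refine le_antisymm (iSup_le fun n => ?_) (iSup_le fun α => le_iSup N _)
    exact (hfn n ▸ le_iSup (fun α => N (f α)) ⟨n, Ordinal.natCast_lt_omega0 n⟩ :)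
  · have : (a : Ordinal) ≤ b := hab
    rw [hf a, hf b] at this
    exact_mod_cast this

end Chains

/-! ### Factorization through free modules and countable presentations. -/

section LocallyFree

variable {R : Type u} [Ring R]
variable {M : Type u} [AddCommGroup M] [Module Rᵐᵒᵖ M]

/-- The inclusion of each finitely generated submodule of `N` into `N` factors through a finitely
generated free module. -/
def FactorsThroughFree (N : Submodule Rᵐᵒᵖ M) : Prop :=
  ∀ (F : Submodule Rᵐᵒᵖ M) (hF : F ≤ N), F.FG →
    ∃ (n : ℕ) (s : F →ₗ[Rᵐᵒᵖ] (Fin n → Rᵐᵒᵖ)) (t : (Fin n → Rᵐᵒᵖ) →ₗ[Rᵐᵒᵖ] N),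
      t ∘ₗ s = Submodule.inclusion hF

/-- The submodule `N` has a countable generating set. -/
def IsCountablyGenerated (N : Submodule Rᵐᵒᵖ M) : Prop :=
  ∃ C : Set M, C.Countable ∧ Submodule.span Rᵐᵒᵖ C = N

theorem isCountablyGenerated_of_fg {N : Submodule Rᵐᵒᵖ M} (hN : N.FG) :
    IsCountablyGenerated N := by
  obtain ⟨s, hs⟩ := hN
  exact ⟨s, s.countable_toSet, hs⟩

theorem isCountablyGenerated_iSup {N : ℕ → Submodule Rᵐᵒᵖ M}
    (hN : ∀ k, IsCountablyGenerated (N k)) : IsCountablyGenerated (⨆ k, N k) := by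
  choose C hC hspan using hN
  exact ⟨⋃ k, C k, Set.countable_iUnion hC, by simp [Submodule.span_iUnion, hspan]⟩

theorem IsCountablyGenerated.exists_sequence {N : Submodule Rᵐᵒᵖ M}
    (hN : IsCountablyGenerated N) :
    ∃ c : ℕ → N, Submodule.span Rᵐᵒᵖ (Set.range c) = ⊤ := by
  obtain ⟨C, hC, rfl⟩ := hN
  obtain ⟨c, hc⟩ := (hC.insert 0).exists_eq_range (Set.insert_nonempty _ _)
  have hspan : Submodule.span Rᵐᵒᵖ (Set.range c) = Submodule.span Rᵐᵒᵖ C := by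
    rw [← hc, Submodule.span_insert_zero]
  have hmem : ∀ k, c k ∈ Submodule.span Rᵐᵒᵖ C := fun k =>
    hspan ▸ Submodule.subset_span ⟨k, rfl⟩
  refine ⟨fun k => ⟨c k, hmem k⟩, ?_⟩
  apply Submodule.map_injective_of_injective (Submodule.span Rᵐᵒᵖ C).subtype_injective
  rw [Submodule.map_span, Submodule.map_top, Submodule.range_subtype, ← Set.range_comp]
  exact hspan

theorem IsCountablyPresented.isCountablyGenerated {N : Submodule Rᵐᵒᵖ M}
    (hN : IsCountablyPresented R N) : IsCountablyGenerated N := by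
  obtain ⟨-, f, -, hf⟩ := hN
  refine ⟨Set.range fun k => (f (Finsupp.single k 1) : M), Set.countable_range _, ?_⟩
  refine le_antisymm (Submodule.span_le.2 ?_) fun x hx => ?_
  · rintro _ ⟨k, rfl⟩
    exact (f _).2
  · obtain ⟨v, hv⟩ := hf ⟨x, hx⟩
    rw [← Subtype.coe_mk x hx, ← hv]
    clear hv
    induction v using Finsupp.induction_linear with
    | zero => simp
    | add v w hv hw => rw [map_add]; exact Submodule.add_mem _ hv hw
    | single k r =>
      rw [← mul_one r, ← smul_eq_mul, ← Finsupp.smul_single, map_smul]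
      exact Submodule.smul_mem _ _ (Submodule.subset_span ⟨k, rfl⟩)

/-- A tensor over a finitely generated submodule that dies in `N ⊗ B` dies over a larger finitely
generated one. From there the inclusion into `N` passes through a free module, where tensoring
preserves injectivity. -/
theorem FactorsThroughFree.isFlat {N : Submodule Rᵐᵒᵖ M} (hN : FactorsThroughFree N) :
    IsFlat R N := by
  let G : {F : Submodule Rᵐᵒᵖ M // F ≤ N ∧ F.FG} → Submodule Rᵐᵒᵖ M := fun F => F
  have : Nonempty {F : Submodule Rᵐᵒᵖ M // F ≤ N ∧ F.FG} := ⟨⟨⊥, bot_le, Submodule.fg_bot⟩⟩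
  have hdir : Directed (· ≤ ·) G := fun F F' =>
    ⟨⟨F ⊔ F', sup_le F.2.1 F'.2.1, F.2.2.sup F'.2.2⟩, le_sup_left, le_sup_right⟩
  have hG : ⨆ F, G F = N := by
    refine le_antisymm (iSup_le fun F => F.2.1) fun x hx => ?_
    exact le_iSup G ⟨Submodule.span Rᵐᵒᵖ {x}, by simpa using hx, Submodule.fg_span_singleton x⟩
      (Submodule.mem_span_singleton_self x)
  suffices IsFlat R (⨆ F, G F : Submodule Rᵐᵒᵖ M) by rwa [hG] at this
  intro A B _ _ _ _ g hg
  refine (injective_iff_map_eq_zero _).2 fun z hz => ?_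
  obtain ⟨i, y, rfl⟩ := exists_tensorMap_inclusion_eq hdir z
  rw [tensorMap_comm] at hz
  obtain ⟨j, hj, -, h0⟩ := exists_tensorMap_inclusion_eq_zero hdir le_rfl hz
  obtain ⟨n, s, t, hst⟩ := hN (G j) j.2.1 j.2.2
  rw [← tensorMap_comm] at h0
  have h1 : tensorMap s LinearMap.id (tensorMap (Submodule.inclusion hj) LinearMap.id y) = 0 := by
    refine (map_eq_zero_iff _ (tensorMap_free_injective n hg)).1 ?_
    rw [tensorMap_comm, h0, map_zero]
  rw [← tensorMap_inclusion_inclusion hj (le_iSup G j)]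
  have h2 : Submodule.inclusion (le_iSup G j) = Submodule.inclusion hG.ge ∘ₗ t ∘ₗ s := by
    rw [hst]; rfl
  rw [h2]
  have h3 := congrArg (tensorMap (Submodule.inclusion hG.ge ∘ₗ t) (LinearMap.id : A →ₗ[R] A)) h1
  rwa [tensorMap_tensorMap, map_zero] at h3

/-- Let `F k` be generated by the first `k` generators and lift `t k` along `f` to `t' k`. The
elements `e_i - t' k (s k (c i))` with `i < k` lie in the kernel of `f`. They generate it: if `v` is
in the kernel and supported below `k`, then `t' k ∘ s k` kills `∑ v i • c i = 0`, so `v` is the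
combination of these elements with coefficients `v i`. -/
theorem FactorsThroughFree.isCountablyPresented {N : Submodule Rᵐᵒᵖ M}
    (hN : FactorsThroughFree N) (hc : IsCountablyGenerated N) : IsCountablyPresented R N := by
  classical
  obtain ⟨c, hc⟩ := hc.exists_sequence
  let f : (ℕ →₀ Rᵐᵒᵖ) →ₗ[Rᵐᵒᵖ] N := Finsupp.linearCombination Rᵐᵒᵖ c
  have hf : Function.Surjective f := by
    rw [← LinearMap.range_eq_top, Finsupp.range_linearCombination, hc]
  let F : ℕ → Submodule Rᵐᵒᵖ M := fun k =>
    Submodule.span Rᵐᵒᵖ ((Finset.range k).image fun i => (c i : M) : Finset M)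
  have hF : ∀ k, F k ≤ N := fun k => Submodule.span_le.2 fun x hx => by
    simp only [Finset.coe_image, Set.mem_image] at hx
    obtain ⟨i, -, rfl⟩ := hx
    exact (c i).2
  have hcF : ∀ {k i}, i < k → (c i : M) ∈ F k := fun {k i} hi =>
    Submodule.subset_span (Finset.mem_coe.2 (Finset.mem_image_of_mem _ (Finset.mem_range.2 hi)))
  choose n s t hst using fun k => hN (F k) (hF k) ⟨_, rfl⟩
  choose t' ht' using fun k => Module.projective_lifting_property f (t k) hf
  have hts : ∀ k (x : F k), f (t' k (s k x)) = Submodule.inclusion (hF k) x := fun k x => by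
    rw [← hst, ← ht']; rfl
  let d : ℕ × ℕ → ℕ →₀ Rᵐᵒᵖ := fun p =>
    if h : p.2 < p.1 then Finsupp.single p.2 1 - t' p.1 (s p.1 ⟨c p.2, hcF h⟩) else 0
  have hfd : ∀ p, f (d p) = 0 := fun p => by
    by_cases h : p.2 < p.1
    · simp only [d, h, dif_pos, map_sub, hts]
      simp only [f, Finsupp.linearCombination_single, one_smul, sub_eq_zero]
      rfl
    · simp [d, h]
  refine ⟨Finsupp.linearCombination Rᵐᵒᵖ (d ∘ Nat.unpair), f, fun v => ⟨fun hv => ?_, ?_⟩, hf⟩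
  · obtain ⟨k, hk⟩ : ∃ k, v.support ⊆ Finset.range k :=
      ⟨v.support.sup id + 1, fun i hi => by
        rw [Finset.mem_range]; exact Nat.lt_succ_of_le (Finset.le_sup (f := id) hi)⟩
    let e : ℕ → F k := fun i => if h : i < k then ⟨c i, hcF h⟩ else 0
    have he : ∑ i ∈ v.support, v i • e i = 0 := by
      apply (F k).subtype_injective
      rw [map_zero, ← Submodule.coe_zero (p := N), ← hv]
      simp only [f, Finsupp.linearCombination_apply, Finsupp.sum, map_sum, map_smul]
      rw [← N.subtype_apply, map_sum]
      refine Finset.sum_congr rfl fun i hi => ?_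
      simp [e, Finset.mem_range.1 (hk hi)]
    have hvd : v = ∑ i ∈ v.support, v i • d (k, i) := by
      have h1 : ∀ i ∈ v.support,
          v i • d (k, i) = Finsupp.single i (v i) - t' k (s k (v i • e i)) := fun i hi => by
        simp only [d, e, dif_pos (Finset.mem_range.1 (hk hi)), smul_sub, map_smul,
          Finsupp.smul_single, smul_eq_mul, mul_one]
      rw [Finset.sum_congr rfl h1, Finset.sum_sub_distrib, ← map_sum, ← map_sum, he, map_zero,
        map_zero, sub_zero]
      exact (Finsupp.sum_single v).symm
    have hd : ∀ p, d p ∈ LinearMap.range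
        (Finsupp.linearCombination Rᵐᵒᵖ (d ∘ Nat.unpair)) := fun p =>
      ⟨Finsupp.single (Nat.pair p.1 p.2) 1, by simp⟩
    change v ∈ LinearMap.range _
    rw [hvd]
    exact Submodule.sum_mem _ fun i _ => Submodule.smul_mem _ _ (hd _)
  · rintro ⟨w, rfl⟩
    simp [Finsupp.linearCombination_apply, Finsupp.sum, map_sum, hfd]

theorem FactorsThroughFree.iSup {N : ℕ → Submodule Rᵐᵒᵖ M} (hmono : Monotone N)
    (hN : ∀ k, FactorsThroughFree (N k)) : FactorsThroughFree (⨆ k, N k) := by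
  intro F hF hfg
  obtain ⟨X, hX⟩ := id hfg
  obtain ⟨k, hk⟩ := exists_subset_of_directed hmono.directed_le X.finite_toSet
    (fun x hx => hF (hX ▸ Submodule.subset_span hx))
  have hFk : F ≤ N k := hX ▸ Submodule.span_le.2 hk
  obtain ⟨n, s, t, hst⟩ := hN k F hFk hfg
  refine ⟨n, s, Submodule.inclusion (le_iSup N k) ∘ₗ t, ?_⟩
  rw [LinearMap.comp_assoc, hst]
  rfl

/-- Over a flat `𝒬`-Mittag-Leffler module, a finite sequence factors through another one in such a
way that all its relations with coefficients in members of `𝒬` become trivial. -/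
theorem exists_uniform_factorization {𝒬 : Set (ModuleCat.{u} R)} (hflat : IsFlat R M)
    (hML : IsMittagLeffler R M 𝒬) {p : ℕ} (m : Fin p → M) :
    ∃ (n : ℕ) (r : Fin n → Fin p → R) (b : Fin n → M),
      (∀ i, m i = ∑ k, MulOpposite.op (r k i) • b k) ∧
      ∀ Q ∈ 𝒬, ∀ q : Fin p → Q, ∑ i, tmul R (m i) (q i) = 0 → ∀ k, ∑ i, r k i • q i = 0 := by
  by_contra hcon
  -- The index set consists of all factorizations of `m`; each supplies a family `q j` on which it
  -- fails.
  let J : Type u := {x : Σ n : ℕ, (Fin n → Fin p → R) × (Fin n → M) //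
    ∀ i, m i = ∑ k, MulOpposite.op (x.2.1 k i) • x.2.2 k}
  have hJ : ∀ j : J, ∃ Q ∈ 𝒬, ∃ q : Fin p → Q, ∑ i, tmul R (m i) (q i) = 0 ∧
      ∃ k, ∑ i, j.1.2.1 k i • q i ≠ 0 := fun j => by
    by_contra hj
    push Not at hj
    exact hcon ⟨_, _, _, j.2, hj⟩
  choose Q hQ q hq k hk using hJ
  have h0 : ∑ i, tmul R (m i) (fun j => q j i) = 0 := by
    refine (map_eq_zero_iff _ (hML J Q hQ)).1 ?_
    ext1 j
    rw [map_sum, Finset.sum_apply]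
    exact hq j
  obtain ⟨n, r, b, hb, hr⟩ := hflat.exists_factorization h0
  -- The factorization obtained over the whole product is itself an index, and it trivializes its
  -- own counterexample.
  let j : J := ⟨⟨n, r, b⟩, hb⟩
  apply hk j
  simpa using congrFun (hr (k j)) j

/-- The uniform factorization of a generating sequence is a map `ρ` between free modules. Membership
of `R` in `𝒬` makes `ρ` kill all linear relations between the generators, so it descends to `F`. -/
theorem exists_factorization_of_fg {𝒬 : Set (ModuleCat.{u} R)} (hR : ModuleCat.of R R ∈ 𝒬)
    (hflat : IsFlat R M) (hML : IsMittagLeffler R M 𝒬) {F : Submodule Rᵐᵒᵖ M} (hF : F.FG) :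
    ∃ (n : ℕ) (s : F →ₗ[Rᵐᵒᵖ] (Fin n → Rᵐᵒᵖ)) (t : (Fin n → Rᵐᵒᵖ) →ₗ[Rᵐᵒᵖ] M),
      t ∘ₗ s = F.subtype ∧ ∀ Q ∈ 𝒬, ∀ z : Tensor R F Q,
        tensorMap F.subtype LinearMap.id z = 0 → tensorMap s LinearMap.id z = 0 := by
  classical
  obtain ⟨p, m, rfl⟩ := Submodule.fg_iff_exists_fin_generating_family.1 hF
  obtain ⟨n, r, b, hb, hr⟩ := exists_uniform_factorization hflat hML m
  let F := Submodule.span Rᵐᵒᵖ (Set.range m)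
  let a' : (Fin p → Rᵐᵒᵖ) →ₗ[Rᵐᵒᵖ] M := Fintype.linearCombination Rᵐᵒᵖ m
  have ha' : ∀ v, a' v ∈ F := fun v => by
    change a' v ∈ Submodule.span Rᵐᵒᵖ (Set.range m)
    rw [← Fintype.range_linearCombination]
    exact ⟨v, rfl⟩
  let a : (Fin p → Rᵐᵒᵖ) →ₗ[Rᵐᵒᵖ] F := a'.codRestrict F ha'
  have ha : Function.Surjective a := fun x => by
    obtain ⟨v, hv⟩ : (x : M) ∈ LinearMap.range a' := by
      rw [Fintype.range_linearCombination]; exact x.2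
    exact ⟨v, Subtype.ext hv⟩
  let ρ : (Fin p → Rᵐᵒᵖ) →ₗ[Rᵐᵒᵖ] (Fin n → Rᵐᵒᵖ) :=
    Fintype.linearCombination Rᵐᵒᵖ fun i k => MulOpposite.op (r k i)
  let t : (Fin n → Rᵐᵒᵖ) →ₗ[Rᵐᵒᵖ] M := Fintype.linearCombination Rᵐᵒᵖ b
  have hker : LinearMap.ker a ≤ LinearMap.ker ρ := fun v hv => by
    have hv' : ∑ i, v i • m i = 0 := congrArg Subtype.val (LinearMap.mem_ker.1 hv)
    -- A linear relation `∑ v i • m i = 0` is a vanishing tensor in `M ⊗ R`.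
    have h1 := hr _ hR (fun i => (v i).unop) (by
      have : ∀ i, tmul R (m i) ((v i).unop : ModuleCat.of R R) =
          tmul R (v i • m i) (1 : R) := fun i => by
        rw [← MulOpposite.op_unop (v i), tmul_balanced]; simp
      simp only [this, ← sum_tmul]
      rw [hv', zero_tmul])
    rw [LinearMap.mem_ker]
    ext1 k
    apply MulOpposite.unop_injective
    have h2 : ∑ i, r k i * (v i).unop = 0 := h1 k
    simpa [ρ, Fintype.linearCombination_apply, Finset.sum_apply] using h2
  let s : F →ₗ[Rᵐᵒᵖ] (Fin n → Rᵐᵒᵖ) :=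
    (LinearMap.ker a).liftQ ρ hker ∘ₗ (a.quotKerEquivOfSurjective ha).symm.toLinearMap
  have hs : s ∘ₗ a = ρ := LinearMap.ext fun v => by
    have : (a.quotKerEquivOfSurjective ha).symm (a v) = (LinearMap.ker a).mkQ v := by
      rw [LinearEquiv.symm_apply_eq]; rfl
    simp only [s, LinearMap.comp_apply, LinearEquiv.coe_coe, this]
    rfl
  have hts : t ∘ₗ ρ = F.subtype ∘ₗ a := by
    refine LinearMap.pi_ext' fun i => LinearMap.ext_ring ?_
    change t (ρ (Pi.single i 1)) = a' (Pi.single i 1)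
    rw [Fintype.linearCombination_apply_single, Fintype.linearCombination_apply_single, one_smul,
      one_smul, hb i, Fintype.linearCombination_apply]
  refine ⟨n, s, t, ?_, fun Q hQ z hz => ?_⟩
  · refine LinearMap.ext fun x => ?_
    obtain ⟨v, rfl⟩ := ha x
    rw [LinearMap.comp_apply, ← LinearMap.comp_apply s, hs]
    exact DFunLike.congr_fun hts v
  · obtain ⟨y, rfl⟩ := tensorMap_surjective_left ha z
    have h1 : ∑ i, tmul R (m i) (freeCoord p i y) = 0 := by
      rw [tensorMap_tensorMap, eq_sum_tmul_freeCoord y, map_sum] at hz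
      rw [← hz]
      refine Finset.sum_congr rfl fun i _ => ?_
      rw [tensorMap_tmul]
      change _ = tmul R (a' (Pi.single i 1)) _
      rw [Fintype.linearCombination_apply_single, one_smul]
      rfl
    rw [tensorMap_tensorMap, hs]
    refine eq_zero_of_freeCoord_eq_zero fun k => ?_
    rw [← hr Q hQ _ h1 k, eq_sum_tmul_freeCoord y, map_sum, map_sum, ← eq_sum_tmul_freeCoord y]
    refine Finset.sum_congr rfl fun i _ => ?_
    rw [tensorMap_tmul, freeCoord_tmul, Fintype.linearCombination_apply_single, one_smul]
    rfl

/-- Each countable subset of a flat `𝒬`-Mittag-Leffler module lies in a submodule with the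
properties required of a member of a system of countably presented submodules. -/
theorem exists_countablyGenerated_submodule {𝒬 : Set (ModuleCat.{u} R)}
    (hR : ModuleCat.of R R ∈ 𝒬) (hflat : IsFlat R M) (hML : IsMittagLeffler R M 𝒬)
    {C : Set M} (hC : C.Countable) :
    ∃ N : Submodule Rᵐᵒᵖ M, C ⊆ N ∧ IsCountablyGenerated N ∧ FactorsThroughFree N ∧
      IsMittagLeffler R N 𝒬 ∧ ∀ Q ∈ 𝒬, StaysInjective R N Q := by
  obtain ⟨c, hc⟩ := (hC.insert 0).exists_eq_range (Set.insert_nonempty _ _)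
  choose n s t hts hker using fun F : {F : Submodule Rᵐᵒᵖ M // F.FG} =>
    exists_factorization_of_fg hR hflat hML F.2
  have hfg : ∀ (F : {F : Submodule Rᵐᵒᵖ M // F.FG}) (x : M),
      (LinearMap.range (t F) ⊔ Submodule.span Rᵐᵒᵖ {x}).FG := fun F x =>
    Submodule.FG.sup (by rw [LinearMap.range_eq_map]; exact Module.Finite.fg_top.map _)
      (Submodule.fg_span_singleton x)
  -- Each stage absorbs the image of the free module attached to the previous one, so the
  -- factorizations end in the union and not merely in `M`; adjoining `c k` exhausts `C`.
  let G : ℕ → {F : Submodule Rᵐᵒᵖ M // F.FG} := fun k =>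
    Nat.rec ⟨⊥, Submodule.fg_bot⟩ (fun k F => ⟨_, hfg F (c k)⟩) k
  have hG : ∀ k, (G (k + 1) : Submodule Rᵐᵒᵖ M) =
      LinearMap.range (t (G k)) ⊔ Submodule.span Rᵐᵒᵖ {c k} := fun k => rfl
  have hle : ∀ F : {F : Submodule Rᵐᵒᵖ M // F.FG}, (F : Submodule Rᵐᵒᵖ M) ≤ LinearMap.range (t F) := fun F x hx =>
    ⟨s F ⟨x, hx⟩, DFunLike.congr_fun (hts F) ⟨x, hx⟩⟩
  let N : ℕ → Submodule Rᵐᵒᵖ M := fun k => (G k).1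
  have hmono : Monotone N := monotone_nat_of_le_succ fun k => by
    change (G k : Submodule Rᵐᵒᵖ M) ≤ G (k + 1)
    rw [hG]
    exact (hle _).trans le_sup_left
  have hrange : ∀ k, LinearMap.range (t (G k)) ≤ ⨆ k, N k := fun k =>
    (le_sup_left.trans (hG k).ge).trans (le_iSup N (k + 1))
  let τ : ∀ k, (Fin (n (G k)) → Rᵐᵒᵖ) →ₗ[Rᵐᵒᵖ] (⨆ k, N k : Submodule Rᵐᵒᵖ M) := fun k =>
    (t (G k)).codRestrict _ fun v => hrange k ⟨v, rfl⟩
  have hτ : ∀ k, τ k ∘ₗ s (G k) = Submodule.inclusion (le_iSup N k) := fun k =>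
    LinearMap.ext fun x => Subtype.ext (DFunLike.congr_fun (hts (G k)) x)
  have hzero : ∀ k {A : Type u} [AddCommGroup A] [Module R A] (y : Tensor R (N k) A),
      tensorMap (s (G k)) (LinearMap.id : A →ₗ[R] A) y = 0 →
        tensorMap (Submodule.inclusion (le_iSup N k)) (LinearMap.id : A →ₗ[R] A) y = 0 :=
    fun k A _ _ y hy => by
      have := congrArg (tensorMap (τ k) (LinearMap.id : A →ₗ[R] A)) hy
      rwa [tensorMap_tensorMap, map_zero, hτ] at this
  refine ⟨⨆ k, N k, fun x hx => ?_, isCountablyGenerated_iSup fun k =>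
    isCountablyGenerated_of_fg (G k).2, fun F hF hFfg => ?_, fun I Q hQ => ?_, fun Q hQ => ?_⟩
  · obtain ⟨k, rfl⟩ : x ∈ Set.range c := hc ▸ Set.mem_insert_of_mem 0 hx
    refine le_iSup N (k + 1) ((hG k).ge (le_sup_right (a := LinearMap.range (t (G k))) ?_))
    exact Submodule.mem_span_singleton_self _
  · obtain ⟨X, hX⟩ := id hFfg
    obtain ⟨k, hk⟩ := exists_subset_of_directed hmono.directed_le X.finite_toSet
      (fun x hx => hF (hX ▸ Submodule.subset_span hx))
    have hFk : F ≤ N k := hX ▸ Submodule.span_le.2 hk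
    refine ⟨n (G k), s (G k) ∘ₗ Submodule.inclusion hFk, τ k, ?_⟩
    rw [← LinearMap.comp_assoc, hτ]
    rfl
  · refine (injective_iff_map_eq_zero _).2 fun z hz => ?_
    obtain ⟨k, y, rfl⟩ := exists_tensorMap_inclusion_eq hmono.directed_le z
    -- The coordinates of `y` vanish over `M`, hence by `hker` over the free module, which is
    -- Mittag-Leffler for every family.
    refine hzero k y ((map_eq_zero_iff _ (tensorPi_free_injective _ _)).1 ?_)
    ext1 i
    rw [tensorPi_tensorMap]
    refine hker (G k) (Q i) (hQ i) _ ?_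
    have h1 : tensorMap (Submodule.inclusion (le_iSup N k)) LinearMap.id
        (tensorPi R (N k) (fun i => Q i) y i) = 0 :=
      (tensorPi_tensorMap (fun i => Q i) _ y i).symm.trans (congrFun hz i)
    exact (tensorMap_subtype_inclusion (le_iSup N k) _).symm.trans (by rw [h1, map_zero])
  · refine (injective_iff_map_eq_zero _).2 fun z hz => ?_
    obtain ⟨k, y, rfl⟩ := exists_tensorMap_inclusion_eq hmono.directed_le z
    rw [tensorMap_subtype_inclusion] at hz
    exact hzero k y (hker (G k) Q hQ y hz)

/-- The system is cut out by countable generation and `FactorsThroughFree` because both visibly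
survive unions of countable chains, and together they give countable presentation and flatness. -/
theorem hasCountablyPresentedSystem {𝒬 : Set (ModuleCat.{u} R)} (hR : ModuleCat.of R R ∈ 𝒬)
    (hflat : IsFlat R M) (hML : IsMittagLeffler R M 𝒬) :
    HasCountablyPresentedSystem R M 𝒬 := by
  refine ⟨{N | IsCountablyGenerated N ∧ FactorsThroughFree N ∧ IsMittagLeffler R N 𝒬 ∧
    ∀ Q ∈ 𝒬, StaysInjective R N Q}, ?_, fun C hC => ?_, fun N hmono hN => ?_⟩
  · rintro N ⟨hcg, hN, hN', hN''⟩
    exact ⟨hN.isCountablyPresented hcg, hN.isFlat, hN', hN''⟩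
  · obtain ⟨N, hCN, hN⟩ := exists_countablyGenerated_submodule hR hflat hML hC
    exact ⟨N, hN, hCN⟩
  · exact ⟨isCountablyGenerated_iSup fun k => (hN k).1,
      FactorsThroughFree.iSup hmono fun k => (hN k).2.1,
      isMittagLeffler_iSup_of_staysInjective hmono.directed_le (fun k => (hN k).2.2.1)
        fun k => (hN k).2.2.2,
      fun Q hQ => staysInjective_iSup hmono.directed_le fun k => (hN k).2.2.2 Q hQ⟩

/-- Directedness comes from (a): two members have countable generating sets, whose union lies in a
third. -/
theorem HasCountablyPresentedSystem.isFlat_and_isMittagLeffler {𝒬 : Set (ModuleCat.{u} R)}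
    (h : HasCountablyPresentedSystem R M 𝒬) : IsFlat R M ∧ IsMittagLeffler R M 𝒬 := by
  obtain ⟨𝒰, h𝒰, hC, hchain⟩ := h
  refine isFlat_and_isMittagLeffler_of_directedOn (fun N hN => ⟨(h𝒰 N hN).2.1, (h𝒰 N hN).2.2.1⟩)
    (fun N hN N' hN' => ?_) (Set.eq_univ_of_forall fun x => ?_) hchain
  · obtain ⟨X, hX, hspan⟩ := (h𝒰 N hN).1.isCountablyGenerated
    obtain ⟨X', hX', hspan'⟩ := (h𝒰 N' hN').1.isCountablyGenerated
    obtain ⟨P, hP, hXP⟩ := hC (X ∪ X') (hX.union hX')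
    refine ⟨P, hP, ?_, ?_⟩
    · rw [← hspan]; exact Submodule.span_le.2 (Set.subset_union_left.trans hXP)
    · rw [← hspan']; exact Submodule.span_le.2 (Set.subset_union_right.trans hXP)
  · obtain ⟨P, hP, hxP⟩ := hC {x} (Set.countable_singleton x)
    simp only [Set.mem_iUnion]
    exact ⟨P, hP, hxP rfl⟩

end LocallyFree

end RelML

/-! ### The equivalences. -/

open RelML in
theorem proposition2p4 {R : Type u} [Ring R] {M : Type u} [AddCommGroup M] [Module Rᵐᵒᵖ M]
    (𝒬 : Set (ModuleCat.{u} R)) (κ : Cardinal.{u}) (hκ : κ = #R + ℵ₀) :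
    -- conditions (i)-(iv) are equivalent
    List.TFAE [
      IsFlat R M ∧ IsMittagLeffler R M 𝒬,
      ∀ C : Set M, #C ≤ κ →
        ∃ N : Submodule Rᵐᵒᵖ M, IsPureSubmodule R N ∧ IsFlat R N ∧ IsMittagLeffler R N 𝒬 ∧
          C ⊆ N ∧ #N ≤ κ,
      ∃ 𝒮 : Set (Submodule Rᵐᵒᵖ M),
        (∀ N ∈ 𝒮, IsPureSubmodule R N ∧ IsFlat R N ∧ IsMittagLeffler R N 𝒬 ∧ #N ≤ κ) ∧
        (∀ C : Set M, #C ≤ κ → ∃ N ∈ 𝒮, C ⊆ N) ∧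
        ClosedUnderChains κ 𝒮,
      ∃ 𝒯 : Set (Submodule Rᵐᵒᵖ M),
        (∀ N ∈ 𝒯, IsFlat R N ∧ IsMittagLeffler R N 𝒬) ∧
        DirectedOn (· ≤ ·) 𝒯 ∧
        (⋃ N ∈ 𝒯, (N : Set M)) = Set.univ ∧
        ClosedUnderCountableChains 𝒯] ∧
    -- (v) implies (i), and is equivalent to (i) if `R ∈ 𝒬`
    (HasCountablyPresentedSystem R M 𝒬 → IsFlat R M ∧ IsMittagLeffler R M 𝒬) ∧
    (ModuleCat.of R R ∈ 𝒬 →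
      (HasCountablyPresentedSystem R M 𝒬 ↔ IsFlat R M ∧ IsMittagLeffler R M 𝒬)) := by
  have h0 : ℵ₀ ≤ κ := hκ ▸ self_le_add_left _ _
  have hR : #R ≤ κ := hκ ▸ self_le_add_right _ _
  refine ⟨?_, fun h => h.isFlat_and_isMittagLeffler, fun hRQ =>
    ⟨fun h => h.isFlat_and_isMittagLeffler, fun h => hasCountablyPresentedSystem hRQ h.1 h.2⟩⟩
  tfae_have 1 → 2 := fun ⟨hflat, hML⟩ C hC => by
    obtain ⟨N, hN, hCN, hcard⟩ := exists_isPureSubmodule h0 hR hC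
    exact ⟨N, hN, hflat.of_pure N.subtype hN, hML.of_pure N.subtype hN, hCN, hcard⟩
  tfae_have 2 → 3 := fun h => by
    refine ⟨{N | IsPureSubmodule R N ∧ IsFlat R N ∧ IsMittagLeffler R N 𝒬 ∧ #N ≤ κ},
      fun N hN => hN, fun C hC => ?_, fun σ hσ0 hσ N hmono hN => ?_⟩
    · obtain ⟨N, hN, hN', hN'', hCN, hcard⟩ := h C hC
      exact ⟨N, ⟨hN, hN', hN'', hcard⟩, hCN⟩
    · have : Nonempty (Set.Iio σ) := ⟨⟨0, hσ0⟩⟩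
      have hcard := mk_iSup_Iio_le h0 hσ0 hσ hmono fun i => (hN i).2.2.2
      have hpure : IsPureSubmodule R (⨆ i, N i) := fun A _ _ =>
        staysInjective_iSup hmono.directed_le fun i => (hN i).1 A
      -- The union of the chain is itself a small subset, so (ii) applies to it, and its purity lets
      -- it inherit from `P`.
      obtain ⟨P, -, hP, hP', hle, -⟩ := h _ hcard
      exact ⟨hpure, hP.of_le_of_pure hle hpure, hP'.of_le_of_pure hle hpure, hcard⟩
  tfae_have 3 → 4 := fun ⟨𝒮, h𝒮, hC, hchain⟩ => by
    refine ⟨𝒮, fun N hN => ⟨(h𝒮 N hN).2.1, (h𝒮 N hN).2.2.1⟩, fun N hN N' hN' => ?_,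
      Set.eq_univ_of_forall fun x => ?_, hchain.closedUnderCountableChains h0⟩
    · obtain ⟨P, hP, hle⟩ := hC (N ∪ N') ((Cardinal.mk_union_le _ _).trans
        (Cardinal.add_le_of_le h0 (h𝒮 N hN).2.2.2 (h𝒮 N' hN').2.2.2))
      exact ⟨P, hP, Set.subset_union_left.trans hle, Set.subset_union_right.trans hle⟩
    · obtain ⟨P, hP, hxP⟩ := hC {x} ((Cardinal.mk_singleton x).trans_le
        (Cardinal.one_le_aleph0.trans h0))
      simp only [Set.mem_iUnion]
      exact ⟨P, hP, hxP rfl⟩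
  tfae_have 4 → 1 := fun ⟨𝒯, h𝒯, hdir, hU, hchain⟩ =>
    isFlat_and_isMittagLeffler_of_directedOn h𝒯 hdir hU hchain
  tfae_finish
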